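/- **Setting.** Let $\Theta\subset\mathbb R$ be an interval, $I_1\subset\mathbb R$ an open set, $I_2\subset\mathbb R$, and for $t\in\Theta$ let $\varphi_t:I_1\to I_2$ be given functions. Let $a,b\in\Theta$ and $\theta\in\,]a,b[$. Let $(\varepsilon_n)_{n\ge0}$ be independent, identically distributed real random variables with values in $I_1$ (almost surely), with law of density $f\ge 0$ on $I_1$; $\varepsilon$ is a variable with this law. Put $X_n=\varphi_\theta(\varepsilon_n)$, $Z_n(t)=\varphi_t^{-1}(X_n)$ and $M(t)=\mathbb E\big[|\varphi_t^{-1}(\varphi_\theta(\varepsilon))-\varepsilon|^2\big]$. Derivatives in $t$ are denoted by $\partial$ and derivatives in $x$ by $d$; derivatives in $t$ are taken within $\Theta$ (one-sided at an end point belonging to $\Theta$). **Assumptions.** - (A1) For every $t\in\Theta$, $\varphi_t$ is a strictly increasing bijection from $I_1$ onto $I_2$. - (A2) For every $y\in I_2$, $t\mapsto\varphi_t^{-1}(y)$ is continuously differentiable on $\Theta$. - (A3) For every $t\in\Theta$, $\mathbb E\big[|\varphi_t^{-1}(\varphi_\theta(\varepsilon))|^2\big]<\infty$. - (A4) For every compact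 $B\subset\Theta$, $\mathbb E\big[\sup_{t\in B}|\partial\varphi_t^{-1}(\varphi_\theta(\varepsilon))|^4\big]<\infty$. - (A5) $(t-\theta)M'(t)>0$ for all $t\in[a,b]$ with $t\neq\theta$. - (A6) For every $y\in I_2$, $t\mapsto\varphi_t^{-1}(y)$ is twice differentiable on $\Theta$, and for every compact $B\subset\Theta$, $\mathbb E\big[\sup_{t\in B}|\partial^2\varphi_t^{-1}(\varphi_\theta(\varepsilon))|^2\big]<\infty$. - (A7) $M''(t)\ge\frac12$ for all $t\in[a,b]$. - (AD1) $f$ is bounded and twice continuously differentiable on $I_1$, with bounded first and second derivatives. - (AD2) For every $t\in\Theta$, $\varphi_t$ is three times continuously differentiable on $I_1$. - (AD3) $\varphi_\theta^{-1}$ is three times continuously differentiable on $I_2$, with bounded derivatives of orders $1,2,3$. - (AD4) $d\varphi_t(x)$, $d^2\varphi_t(x)$, $d^3\varphi_t(x)$ are bounded on $\Theta\times I_1$. - (AD5) $(t,x)\mapsto\varphi_t(x)$ is twice continuously differentiable on $\Theta\times I_1$, and for every $x\in I_1$, $\sup_{t\in\Theta}|\partial\varphi_t(x)|<\infty$ and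 $\sup_{t\in\Theta}|\partial d\varphi_t(x)|<\infty$. **Estimators.** Let $(\gamma_n)_{n\ge1}$ be a nonincreasing sequence of positive reals with $\sum\gamma_n=\infty$ and $\sum\gamma_n^2<\infty$ (for example $\gamma_n=1/n$), let $\widehat\theta_0\in[a,b]$ be deterministic and, with $\pi_{[a,b]}$ the projection of $\mathbb R$ onto $[a,b]$, $$\widehat\theta_{n+1}=\pi_{[a,b]}\big(\widehat\theta_n-\gamma_{n+1}T_{n+1}\big),\qquad T_{n+1}=-2\,\partial\varphi^{-1}_{\widehat\theta_n}(X_{n+1})\big(\varepsilon_{n+1}-\varphi^{-1}_{\widehat\theta_n}(X_{n+1})\big).$$ Let $K:\mathbb R\to[0,\infty)$ be symmetric, integrable and bounded with $\int K=1$, $\lim_{|u|\to\infty}|u|K(u)=0$ and $\int u^2K(u)\,du<\infty$. Let $(h_n)_{n\ge1}$ be a nonincreasing sequence of positive reals with $h_n\to0$ and $nh_n\to\infty$ (for example $h_n=n^{-\alpha}$ with $0<\alpha<1$), and put $$\widehat f_n(x)=\frac1n\sum_{i=1}^n\frac1{h_i}K\!\left(\frac{x-Z_i(\widehat\theta_{i-1})}{h_i}\right).$$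 **Theorem.** For every $x\in I_1$, $\widehat f_n(x)$ is square integrable for every $n$ and $$\mathbb E\Big[\big|\widehat f_n(x)-f(x)\big|^2\Big]\xrightarrow[n\to\infty]{}0 .$$ -/

import Mathlib

open MeasureTheory ProbabilityTheory Filter Topology Set

noncomputable section

namespace Deformation

/-- `φ_t⁻¹(y)`: the inverse of the deformation `φ_t` on `I₁`. -/
def inv (φ : ℝ → ℝ → ℝ) (I₁ : Set ℝ) (t y : ℝ) : ℝ :=
  Function.invFunOn (φ t) I₁ y

/-- `∂φ_t⁻¹(y)`: the derivative of `t ↦ φ_t⁻¹(y)` on the parameter interval `Θ`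
(one-sided at an end point of `Θ` that belongs to `Θ`). -/
def dInv (φ : ℝ → ℝ → ℝ) (I₁ Θ : Set ℝ) (t y : ℝ) : ℝ :=
  derivWithin (fun s => inv φ I₁ s y) Θ t

/-- `∂²φ_t⁻¹(y)`: the second derivative of `t ↦ φ_t⁻¹(y)` on `Θ`. -/
def ddInv (φ : ℝ → ℝ → ℝ) (I₁ Θ : Set ℝ) (t y : ℝ) : ℝ :=
  derivWithin (fun s => dInv φ I₁ Θ s y) Θ t

variable {Ω : Type*}

/-- The observations `X_n = φ_θ(ε_n)`. -/
def X (φ : ℝ → ℝ → ℝ) (θ : ℝ) (ε : ℕ → Ω → ℝ) (n : ℕ) (ω : Ω) : ℝ :=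
  φ θ (ε n ω)

/-- The registered variables `Z_n(t) = φ_t⁻¹(X_n)`. -/
def Z (φ : ℝ → ℝ → ℝ) (I₁ : Set ℝ) (θ : ℝ) (ε : ℕ → Ω → ℝ) (n : ℕ) (t : ℝ) (ω : Ω) : ℝ :=
  inv φ I₁ t (X φ θ ε n ω)

/-- The criterion `M(t) = 𝔼|Z(t) - ε|²`. -/
def M [MeasurableSpace Ω] (P : Measure Ω) (φ : ℝ → ℝ → ℝ) (I₁ : Set ℝ) (θ : ℝ)
    (ε : ℕ → Ω → ℝ) (t : ℝ) : ℝ :=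
  ∫ ω, |Z φ I₁ θ ε 0 t ω - ε 0 ω| ^ 2 ∂P

/-- The derivative `M'` of the criterion on `Θ`. -/
def dM [MeasurableSpace Ω] (P : Measure Ω) (φ : ℝ → ℝ → ℝ) (I₁ Θ : Set ℝ) (θ : ℝ)
    (ε : ℕ → Ω → ℝ) (t : ℝ) : ℝ :=
  derivWithin (M P φ I₁ θ ε) Θ t

/-- The second derivative `M''` of the criterion on `Θ`. -/
def ddM [MeasurableSpace Ω] (P : Measure Ω) (φ : ℝ → ℝ → ℝ) (I₁ Θ : Set ℝ) (θ : ℝ)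
    (ε : ℕ → Ω → ℝ) (t : ℝ) : ℝ :=
  derivWithin (dM P φ I₁ Θ θ ε) Θ t

/-- The projection of the real line onto the segment `[a, b]`. -/
def proj (a b x : ℝ) : ℝ := max a (min b x)

/-- The update `-2 ∂φ_t⁻¹(X_n) (ε_n - φ_t⁻¹(X_n))` computed from the `n`-th observation at the
current parameter value `t`. -/
def T (φ : ℝ → ℝ → ℝ) (I₁ Θ : Set ℝ) (θ : ℝ) (ε : ℕ → Ω → ℝ) (n : ℕ) (t : ℝ) (ω : Ω) : ℝ :=
  -2 * dInv φ I₁ Θ t (X φ θ ε n ω) * (ε n ω - inv φ I₁ t (X φ θ ε n ω))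

/-- The projected Robbins-Monro algorithm
`θ̂_{n+1} = π_{[a,b]}(θ̂_n - γ_{n+1} T_{n+1})` with deterministic initial value `θ₀`. -/
def thetaHat (φ : ℝ → ℝ → ℝ) (I₁ Θ : Set ℝ) (θ : ℝ) (ε : ℕ → Ω → ℝ) (a b : ℝ) (γ : ℕ → ℝ)
    (θ₀ : ℝ) : ℕ → Ω → ℝ
  | 0, _ => θ₀
  | n + 1, ω =>
    proj a b (thetaHat φ I₁ Θ θ ε a b γ θ₀ n ω -
      γ (n + 1) * T φ I₁ Θ θ ε (n + 1) (thetaHat φ I₁ Θ θ ε a b γ θ₀ n ω) ω)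

/-- The recursive kernel density estimator
`f̂_n(x) = (1/n) ∑_{i=1}^n (1/h_i) K((x - Z_i(θ̂_{i-1})) / h_i)`. -/
def fHat (φ : ℝ → ℝ → ℝ) (I₁ Θ : Set ℝ) (θ : ℝ) (ε : ℕ → Ω → ℝ) (a b : ℝ) (γ : ℕ → ℝ)
    (θ₀ : ℝ) (K : ℝ → ℝ) (h : ℕ → ℝ) (n : ℕ) (x : ℝ) (ω : Ω) : ℝ :=
  (1 / (n : ℝ)) * ∑ i ∈ Finset.Icc 1 n,
    (1 / h i) *
      K ((x - Z φ I₁ θ ε i (thetaHat φ I₁ Θ θ ε a b γ θ₀ (i - 1) ω) ω) / h i)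

end Deformation

end

/-! The proof combines mean square convergence of `θ̂_n` to `θ` with a bias-variance split of the
estimator along the algorithm.

Algorithm. Let H(t,e) = -2 ∂φ_t⁻¹(φ_θ(e)) (e - φ_t⁻¹(φ_θ(e))). Differentiation under the integral
identifies the mean field ∫ H(t,·) with M'(t). As M is minimal at the interior point θ and M'' ≥
1/2, (t-θ) M'(t) ≥ (t-θ)²/2. If L(e) bounds |∂φ_t⁻¹(φ_θ(e))| over t in [a,b], the mean value
inequality gives |H(t,e)| ≤ 2 L(e)² |t-θ|. The noise therefore dies out at θ, and 𝔼 L⁴ < ∞ bounds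
the second moment of H(t,·) by a multiple of (t-θ)². Since `θ̂_n` is independent of ε_{n+1}, V_n =
𝔼(θ̂_n-θ)² satisfies V_{n+1} ≤ (1 - γ_{n+1} + C γ_{n+1}²) V_n, which forces V_n → 0
(`tendsto_integral_robbinsMonro_sub_sq`).

Estimator. For frozen t, Z_i(t) has the density `registeredDensity`, bounded uniformly in t ∈ [a,b]
and, jointly in (t,z), tending to f(x) at (θ,x). Each summand is centred by its conditional mean
m_i(θ̂_{i-1}). The centred terms are orthogonal with variance O(1/h_i), so they contribute O(1/(n
h_n)) (`integral_sum_centred_sq_le`). The function m_i is bounded, and m_i(t) is close to f(x) for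
large i and t near θ; hence m_i(θ̂_{i-1}) → f(x) in mean square
(`tendsto_integral_comp_robbinsMonro_sq`), and so do the Cesàro means.

Measurability needs care, because φ is uncontrolled off I₁ and K need not be Borel. The deformations
are cut off outside I₁ with the parameter projected on [a,b] (`registration`), and K is replaced by
a Borel version. Neither change is seen almost surely: ε_n lies in I₁, and the frozen Z_i(t) has a
law absolutely continuous with respect to Lebesgue measure. -/

namespace Deformation

/-! ### Recursions driven by an independent sequence -/

section Recursion

variable {Ω : Type*} [MeasurableSpace Ω] {P : Measure Ω} {β : Type*} [MeasurableSpace β]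

/-- A process driven by a recursion is measurable with respect to the natural filtration of the
noise. -/
theorem measurable_natural_of_recursion {ε : ℕ → Ω → ℝ} (hε : ∀ n, StronglyMeasurable (ε n))
    {U : ℕ → Ω → β} {u₀ : β} {F : ℕ → β × ℝ → β} (hF : ∀ n, Measurable (F n))
    (h0 : ∀ ω, U 0 ω = u₀) (hU : ∀ n ω, U (n + 1) ω = F n (U n ω, ε (n + 1) ω)) (n : ℕ) :
    Measurable[Filtration.natural ε hε n] (U n) := by
  induction n with
  | zero =>
    have : U 0 = fun _ => u₀ := funext h0
    rw [this]
    exact measurable_const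
  | succ n ih =>
    have : U (n + 1) = fun ω => F n (U n ω, ε (n + 1) ω) := funext (hU n)
    rw [this]
    refine (hF n).comp (Measurable.prodMk ?_ ?_)
    · exact ih.mono ((Filtration.natural ε hε).mono n.le_succ) le_rfl
    · exact ((Filtration.stronglyAdapted_natural hε) (n + 1)).measurable

theorem measurable_of_recursion {ε : ℕ → Ω → ℝ} (hε : ∀ n, Measurable (ε n))
    {U : ℕ → Ω → β} {u₀ : β} {F : ℕ → β × ℝ → β} (hF : ∀ n, Measurable (F n))
    (h0 : ∀ ω, U 0 ω = u₀) (hU : ∀ n ω, U (n + 1) ω = F n (U n ω, ε (n + 1) ω)) (n : ℕ) :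
    Measurable (U n) :=
  (measurable_natural_of_recursion (fun n => (hε n).stronglyMeasurable) hF h0 hU n).mono
    (Filtration.le _ _) le_rfl

/-- A process driven by a recursion is independent of the next noise variable. -/
theorem indepFun_of_recursion {ε : ℕ → Ω → ℝ} (hε : ∀ n, Measurable (ε n))
    (hindep : iIndepFun ε P) {U : ℕ → Ω → β} {u₀ : β} {F : ℕ → β × ℝ → β}
    (hF : ∀ n, Measurable (F n)) (h0 : ∀ ω, U 0 ω = u₀)
    (hU : ∀ n ω, U (n + 1) ω = F n (U n ω, ε (n + 1) ω)) (n : ℕ) :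
    IndepFun (U n) (ε (n + 1)) P := by
  have h1 := hindep.indep_comap_natural_of_lt (fun n => (hε n).stronglyMeasurable)
    (Nat.lt_succ_self n)
  rw [IndepFun_iff_Indep]
  exact indep_of_indep_of_le_left h1.symm
    (measurable_natural_of_recursion (fun n => (hε n).stronglyMeasurable) hF h0 hU n).comap_le

theorem integrable_integral_of_indepFun [IsProbabilityMeasure P] {U : Ω → β} {e : Ω → ℝ}
    (hU : Measurable U) (he : Measurable e) (hind : IndepFun U e P) {Φ : β × ℝ → ℝ}
    (hΦ : Measurable Φ) (hi : Integrable (fun ω => Φ (U ω, e ω)) P) :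
    Integrable (fun ω => ∫ y, Φ (U ω, y) ∂(P.map e)) P := by
  have hpr := (indepFun_iff_map_prod_eq_prod_map_map hU.aemeasurable he.aemeasurable).1 hind
  have := Measure.isProbabilityMeasure_map (μ := P) hU.aemeasurable
  have := Measure.isProbabilityMeasure_map (μ := P) he.aemeasurable
  have h1 : Integrable Φ ((P.map U).prod (P.map e)) := by
    rw [← hpr]
    exact (integrable_map_measure hΦ.aestronglyMeasurable (hU.prodMk he).aemeasurable).2 hi
  exact (integrable_map_measure h1.integral_prod_left.aestronglyMeasurable hU.aemeasurable).1
    h1.integral_prod_left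

/-- Integrating out a variable that is independent of `U`. -/
theorem integral_eq_of_indepFun [IsProbabilityMeasure P] {U : Ω → β} {e : Ω → ℝ}
    (hU : Measurable U) (he : Measurable e) (hind : IndepFun U e P) {Φ : β × ℝ → ℝ}
    (hΦ : Measurable Φ) (hi : Integrable (fun ω => Φ (U ω, e ω)) P) :
    ∫ ω, Φ (U ω, e ω) ∂P = ∫ ω, ∫ y, Φ (U ω, y) ∂(P.map e) ∂P := by
  have hpr := (indepFun_iff_map_prod_eq_prod_map_map hU.aemeasurable he.aemeasurable).1 hind
  have := Measure.isProbabilityMeasure_map (μ := P) hU.aemeasurable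
  have := Measure.isProbabilityMeasure_map (μ := P) he.aemeasurable
  have h1 : Integrable Φ ((P.map U).prod (P.map e)) := by
    rw [← hpr]
    exact (integrable_map_measure hΦ.aestronglyMeasurable (hU.prodMk he).aemeasurable).2 hi
  rw [← integral_map (hU.prodMk he).aemeasurable hΦ.aestronglyMeasurable, hpr,
    integral_prod _ h1,
    integral_map hU.aemeasurable h1.integral_prod_left.aestronglyMeasurable]

/-- An almost sure property of `(u, e)` for every frozen `u` holds almost surely for `(U, e)` when
`U` and `e` are independent. -/
theorem ae_of_indepFun [IsProbabilityMeasure P] {U : Ω → β} {e : Ω → ℝ}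
    (hU : Measurable U) (he : Measurable e) (hind : IndepFun U e P) {s : Set (β × ℝ)}
    (hs : MeasurableSet s) (h : ∀ ω, ∀ᵐ y ∂(P.map e), (U ω, y) ∈ s) :
    ∀ᵐ ω ∂P, (U ω, e ω) ∈ s := by
  have hpr := (indepFun_iff_map_prod_eq_prod_map_map hU.aemeasurable he.aemeasurable).1 hind
  have := Measure.isProbabilityMeasure_map (μ := P) hU.aemeasurable
  have := Measure.isProbabilityMeasure_map (μ := P) he.aemeasurable
  have key : ∀ᵐ p ∂(P.map (fun ω => (U ω, e ω))), p ∈ s := by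
    rw [hpr, ae_iff]
    change ((P.map U).prod (P.map e)) sᶜ = 0
    -- Fubini for null sets: it suffices that almost every section of the complement is null.
    rw [Measure.measure_prod_null hs.compl]
    rw [Filter.EventuallyEq, ae_map_iff hU.aemeasurable]
    · exact Filter.Eventually.of_forall fun ω => h ω
    · exact measurable_measure_prodMk_left hs.compl (measurableSet_singleton 0)
  exact ae_of_ae_map (hU.prodMk he).aemeasurable key

end Recursion

/-! ### The projected Robbins-Monro algorithm -/

/-- By 1 + u ≤ exp u, iterating the recursion bounds V_n by V_0 exp(C ∑ g² - ∑ g). The first sum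
stays bounded and the second diverges. -/
theorem tendsto_zero_of_le_one_sub_mul {V g : ℕ → ℝ} {C : ℝ} (hV : ∀ n, 0 ≤ V n)
    (hg : ∀ n, 0 ≤ g n) (hC : 0 ≤ C) (hsum : ¬ Summable g) (hsq : Summable fun n => g n ^ 2)
    (hrec : ∀ n, V (n + 1) ≤ (1 - g n + C * g n ^ 2) * V n) : Tendsto V atTop (𝓝 0) := by
  have hb : ∀ n, V n ≤ V 0 * Real.exp (C * ∑' i, g i ^ 2 - ∑ i ∈ Finset.range n, g i) := by
    intro n
    have h1 : V n ≤ V 0 * Real.exp (C * ∑ i ∈ Finset.range n, g i ^ 2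
        - ∑ i ∈ Finset.range n, g i) := by
      induction n with
      | zero => simp
      | succ n ih =>
        have h2 : 1 - g n + C * g n ^ 2 ≤ Real.exp (C * g n ^ 2 - g n) := by
          have := Real.add_one_le_exp (C * g n ^ 2 - g n)
          linarith
        calc V (n + 1) ≤ (1 - g n + C * g n ^ 2) * V n := hrec n
          _ ≤ Real.exp (C * g n ^ 2 - g n) * V n := mul_le_mul_of_nonneg_right h2 (hV n)
          _ ≤ Real.exp (C * g n ^ 2 - g n) * (V 0 * Real.exp (C * ∑ i ∈ Finset.range n, g i ^ 2
                - ∑ i ∈ Finset.range n, g i)) := by gcongr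
          _ = _ := by
            rw [mul_left_comm, ← Real.exp_add, Finset.sum_range_succ, Finset.sum_range_succ]
            ring_nf
    refine h1.trans ?_
    have := hsq.sum_le_tsum (Finset.range n) (fun i _ => sq_nonneg (g i))
    have := hV 0
    gcongr
  have hlim : Tendsto (fun n => V 0 * Real.exp (C * ∑' i, g i ^ 2 - ∑ i ∈ Finset.range n, g i))
      atTop (𝓝 0) := by
    have h1 := (not_summable_iff_tendsto_nat_atTop_of_nonneg hg).1 hsum
    have h2 : Tendsto (fun n => C * ∑' i, g i ^ 2 - ∑ i ∈ Finset.range n, g i) atTop atBot :=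
      tendsto_atBot_add_const_left _ _ (tendsto_neg_atTop_atBot.comp h1)
    simpa using (Real.tendsto_exp_atBot.comp h2).const_mul (V 0)
  exact squeeze_zero hV hb hlim

theorem proj_mem_Icc {a b : ℝ} (hab : a ≤ b) (x : ℝ) : proj a b x ∈ Icc a b :=
  ⟨le_max_left _ _, max_le hab (min_le_left _ _)⟩

theorem proj_of_mem_Icc {a b x : ℝ} (hx : x ∈ Icc a b) : proj a b x = x := by
  simp [proj, hx.1, hx.2]

theorem continuous_proj (a b : ℝ) : Continuous (proj a b) := by
  unfold proj; fun_prop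

/-- The projection is nonexpansive and fixes t, so projecting never increases the error of the
algorithm. -/
theorem abs_proj_sub_le {a b t : ℝ} (ht : t ∈ Icc a b) (x : ℝ) :
    |proj a b x - t| ≤ |x - t| := by
  obtain ⟨h1, h2⟩ := ht
  unfold proj
  rcases max_cases a (min b x) with h | h <;> rcases min_cases b x with h' | h' <;>
    rcases abs_cases (x - t) with h'' | h'' <;> rw [abs_le] <;> constructor <;> linarith

/-- The projected Robbins-Monro recursion with field `H` and noise `ε`. -/
def robbinsMonro {Ω : Type*} (H : ℝ → ℝ → ℝ) (ε : ℕ → Ω → ℝ) (a b : ℝ) (γ : ℕ → ℝ) (θ₀ : ℝ) :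
    ℕ → Ω → ℝ
  | 0, _ => θ₀
  | n + 1, ω =>
    proj a b (robbinsMonro H ε a b γ θ₀ n ω -
      γ (n + 1) * H (robbinsMonro H ε a b γ θ₀ n ω) (ε (n + 1) ω))

theorem robbinsMonro_mem_Icc {Ω : Type*} {ε : ℕ → Ω → ℝ} {H : ℝ → ℝ → ℝ} {a b θ₀ : ℝ}
    {γ : ℕ → ℝ} (hab : a ≤ b) (hθ₀ : θ₀ ∈ Icc a b) (n : ℕ)
    (ω : Ω) :
    robbinsMonro H ε a b γ θ₀ n ω ∈ Icc a b := by
  cases n with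
  | zero => exact hθ₀
  | succ n => exact proj_mem_Icc hab _

section RobbinsMonro

variable {Ω : Type*} [MeasurableSpace Ω] {P : Measure Ω} {ε : ℕ → Ω → ℝ} {H : ℝ → ℝ → ℝ}
  {a b θ θ₀ : ℝ} {γ : ℕ → ℝ} {μ : Measure ℝ}

theorem measurable_robbinsMonro_step (hH : Measurable (Function.uncurry H)) (c : ℝ) :
    Measurable fun p : ℝ × ℝ => proj a b (p.1 - c * H p.1 p.2) :=
  (continuous_proj a b).measurable.comp (measurable_fst.sub (hH.const_mul c))

theorem measurable_robbinsMonro (hε : ∀ n, Measurable (ε n))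
    (hH : Measurable (Function.uncurry H)) (n : ℕ) :
    Measurable (robbinsMonro H ε a b γ θ₀ n) :=
  measurable_of_recursion hε (F := fun n p => proj a b (p.1 - γ (n + 1) * H p.1 p.2))
    (fun _ => measurable_robbinsMonro_step hH _) (fun _ => rfl) (fun _ _ => rfl) n

theorem indepFun_robbinsMonro (hε : ∀ n, Measurable (ε n)) (hindep : iIndepFun ε P)
    (hH : Measurable (Function.uncurry H)) (n : ℕ) :
    IndepFun (robbinsMonro H ε a b γ θ₀ n) (ε (n + 1)) P :=
  indepFun_of_recursion hε hindep (F := fun n p => proj a b (p.1 - γ (n + 1) * H p.1 p.2))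
    (fun _ => measurable_robbinsMonro_step hH _) (fun _ => rfl) (fun _ _ => rfl) n

theorem integrable_of_measurable_of_abs_le [IsFiniteMeasure P] {g : Ω → ℝ} (hg : Measurable g)
    {C : ℝ} (h : ∀ ω, |g ω| ≤ C) : Integrable g P :=
  Integrable.of_bound hg.aestronglyMeasurable C (Eventually.of_forall h)

theorem integrable_robbinsMonro_sub_sq [IsProbabilityMeasure P] (hε : ∀ n, Measurable (ε n))
    (hH : Measurable (Function.uncurry H)) (hθ : θ ∈ Icc a b) (hθ₀ : θ₀ ∈ Icc a b) (n : ℕ) :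
    Integrable (fun ω => (robbinsMonro H ε a b γ θ₀ n ω - θ) ^ 2) P := by
  refine integrable_of_measurable_of_abs_le
    (((measurable_robbinsMonro hε hH n).sub_const θ).pow_const 2) (C := (b - a) ^ 2) fun ω => ?_
  have h1 := robbinsMonro_mem_Icc (H := H) (ε := ε) (γ := γ) (hθ.1.trans hθ.2) hθ₀ n ω
  rw [abs_of_nonneg (sq_nonneg _)]
  exact sq_le_sq' (by linarith [h1.1, hθ.2]) (by linarith [h1.2, hθ.1])

/-- Mean square convergence of the projected Robbins-Monro algorithm under a strong monotonicity
assumption on the mean field. -/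
theorem tendsto_integral_robbinsMonro_sub_sq [IsProbabilityMeasure P]
    (hε : ∀ n, Measurable (ε n)) (hindep : iIndepFun ε P) (hlaw : ∀ n, P.map (ε n) = μ)
    (hH : Measurable (Function.uncurry H)) (hθ : θ ∈ Icc a b) (hθ₀ : θ₀ ∈ Icc a b)
    {Q : ℝ → ℝ} (hQ : MemLp Q 2 μ)
    (hHQ : ∀ᵐ e ∂μ, ∀ t ∈ Icc a b, |H t e| ≤ Q e * |t - θ|)
    (hmono : ∀ t ∈ Icc a b, (t - θ) ^ 2 / 2 ≤ (t - θ) * ∫ e, H t e ∂μ)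
    (hγpos : ∀ n, 1 ≤ n → 0 < γ n)
    (hγsum : ¬ Summable (fun n => γ (n + 1))) (hγsq : Summable (fun n => γ (n + 1) ^ 2)) :
    Tendsto (fun n => ∫ ω, (robbinsMonro H ε a b γ θ₀ n ω - θ) ^ 2 ∂P) atTop (𝓝 0) := by
  have hab : a ≤ b := hθ.1.trans hθ.2
  set R := robbinsMonro H ε a b γ θ₀ with hR
  have hRm : ∀ n, Measurable (R n) := fun n => measurable_robbinsMonro hε hH n
  have hRi : ∀ n, Integrable (fun ω => (R n ω - θ) ^ 2) P := fun n =>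
    integrable_robbinsMonro_sub_sq hε hH hθ hθ₀ n
  have hRI : ∀ n ω, R n ω ∈ Icc a b := fun n ω => robbinsMonro_mem_Icc hab hθ₀ n ω
  have hRd : ∀ n ω, |R n ω - θ| ≤ b - a := fun n ω => by
    have h1 := hRI n ω
    rw [abs_le]
    constructor <;> linarith [h1.1, h1.2, hθ.1, hθ.2]
  have hQsq : Integrable (fun e => Q e ^ 2) μ := hQ.integrable_sq
  have hQn : ∀ n, Integrable (fun ω => Q (ε n ω) ^ 2) P := fun n => by
    have := hQsq
    rw [← hlaw n] at this
    exact (integrable_map_measure this.aestronglyMeasurable (hε n).aemeasurable).1 this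
  have hae : ∀ n, ∀ᵐ ω ∂P, ∀ t ∈ Icc a b, |H t (ε n ω)| ≤ Q (ε n ω) * |t - θ| := fun n => by
    rw [← hlaw n] at hHQ
    exact ae_of_ae_map (hε n).aemeasurable hHQ
  have hHm : ∀ n, Measurable fun ω => H (R n ω) (ε (n + 1) ω) := fun n =>
    hH.comp ((hRm n).prodMk (hε (n + 1)))
  have hH2 : ∀ n, Integrable (fun ω => H (R n ω) (ε (n + 1) ω) ^ 2) P := fun n => by
    refine ((hQn (n + 1)).const_mul ((b - a) ^ 2)).mono'
      ((hHm n).pow_const 2).aestronglyMeasurable ?_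
    filter_upwards [hae (n + 1)] with ω hω
    rw [Real.norm_of_nonneg (sq_nonneg _), ← sq_abs, mul_comm, ← mul_pow]
    have h1 := hω _ (hRI n ω)
    have h2 : 0 ≤ Q (ε (n + 1) ω) * |R n ω - θ| := (abs_nonneg _).trans h1
    calc |H (R n ω) (ε (n + 1) ω)| ^ 2 ≤ (Q (ε (n + 1) ω) * |R n ω - θ|) ^ 2 := by gcongr
      _ = Q (ε (n + 1) ω) ^ 2 * |R n ω - θ| ^ 2 := by ring
      _ ≤ Q (ε (n + 1) ω) ^ 2 * (b - a) ^ 2 := by gcongr; exact hRd n ω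
      _ = _ := by ring
  have hH1 : ∀ n, Integrable (fun ω => H (R n ω) (ε (n + 1) ω)) P := fun n =>
    ((memLp_two_iff_integrable_sq (hHm n).aestronglyMeasurable).2 (hH2 n)).integrable
      one_le_two
  have hc1 : ∀ n, Integrable (fun ω => (R n ω - θ) * H (R n ω) (ε (n + 1) ω)) P := fun n =>
    (hH1 n).bdd_mul (c := b - a) ((hRm n).sub_const θ).aestronglyMeasurable
      (Eventually.of_forall (hRd n))
  have hind := fun n => indepFun_robbinsMonro (a := a) (b := b) (γ := γ) (θ₀ := θ₀)
    hε hindep hH n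
  -- Independence of `R n` and `ε (n + 1)` allows the noise to be integrated out first, at a frozen
  -- parameter; strong monotonicity then applies pointwise.
  have hcross : ∀ n, (∫ ω, (R n ω - θ) ^ 2 ∂P) / 2 ≤
      ∫ ω, (R n ω - θ) * H (R n ω) (ε (n + 1) ω) ∂P := fun n => by
    have hm : Measurable fun p : ℝ × ℝ => (p.1 - θ) * H p.1 p.2 :=
      (measurable_fst.sub_const θ).mul hH
    have h1 := integral_eq_of_indepFun (hRm n) (hε (n + 1)) (hind n) hm (hc1 n)
    have h2 := integrable_integral_of_indepFun (hRm n) (hε (n + 1)) (hind n) hm (hc1 n)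
    simp only [hlaw] at h1 h2
    rw [h1, ← integral_div]
    refine integral_mono ((hRi n).div_const 2) h2 fun ω => ?_
    simp only [integral_const_mul]
    exact hmono _ (hRI n ω)
  -- The bound is proportional to the current error, with no additive noise term, because the field
  -- vanishes at θ almost surely.
  have hquad : ∀ n, ∫ ω, H (R n ω) (ε (n + 1) ω) ^ 2 ∂P ≤
      (∫ e, Q e ^ 2 ∂μ) * ∫ ω, (R n ω - θ) ^ 2 ∂P := fun n => by
    have hm : Measurable fun p : ℝ × ℝ => H p.1 p.2 ^ 2 := Measurable.pow_const hH 2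
    have h1 := integral_eq_of_indepFun (hRm n) (hε (n + 1)) (hind n) hm (hH2 n)
    have h2 := integrable_integral_of_indepFun (hRm n) (hε (n + 1)) (hind n) hm (hH2 n)
    simp only [hlaw] at h1 h2
    rw [h1, ← integral_const_mul]
    refine integral_mono h2 ((hRi n).const_mul _) fun ω => ?_
    simp only
    rw [← integral_mul_const]
    refine integral_mono_of_nonneg (Eventually.of_forall fun _ => sq_nonneg _)
      (hQsq.mul_const _) ?_
    filter_upwards [hHQ] with e he
    have := he _ (hRI n ω)
    calc H (R n ω) e ^ 2 = |H (R n ω) e| ^ 2 := (sq_abs _).symm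
      _ ≤ (Q e * |R n ω - θ|) ^ 2 := by gcongr
      _ = _ := by rw [mul_pow, sq_abs]
  -- The coefficient of γ is exactly 1: the factor 2 from expanding the square cancels the 1/2 of
  -- the monotonicity bound.
  refine tendsto_zero_of_le_one_sub_mul (g := fun n => γ (n + 1)) (C := ∫ e, Q e ^ 2 ∂μ)
    (fun n => integral_nonneg fun _ => sq_nonneg _) (fun n => (hγpos _ (by omega)).le)
    (integral_nonneg fun _ => sq_nonneg _) hγsum hγsq fun n => ?_
  have hstep : ∀ ω, (R (n + 1) ω - θ) ^ 2 ≤ (R n ω - θ) ^ 2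
      - 2 * γ (n + 1) * ((R n ω - θ) * H (R n ω) (ε (n + 1) ω))
      + γ (n + 1) ^ 2 * H (R n ω) (ε (n + 1) ω) ^ 2 := fun ω => by
    have h1 : |R (n + 1) ω - θ| ≤ |R n ω - γ (n + 1) * H (R n ω) (ε (n + 1) ω) - θ| :=
      abs_proj_sub_le hθ _
    have := sq_le_sq.2 h1
    linarith
  have hsub : Integrable (fun ω => (R n ω - θ) ^ 2
      - 2 * γ (n + 1) * ((R n ω - θ) * H (R n ω) (ε (n + 1) ω))) P :=
    (hRi n).sub ((hc1 n).const_mul _)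
  have h3 := integral_mono (hRi (n + 1)) (hsub.add ((hH2 n).const_mul (γ (n + 1) ^ 2))) hstep
  simp only [Pi.add_apply] at h3
  rw [integral_add hsub ((hH2 n).const_mul _), integral_sub (hRi n) ((hc1 n).const_mul _),
    integral_const_mul, integral_const_mul] at h3
  have h4 : 0 < γ (n + 1) := hγpos _ (by omega)
  have h5 := mul_le_mul_of_nonneg_left (hcross n) h4.le
  have h6 := mul_le_mul_of_nonneg_left (hquad n) (sq_nonneg (γ (n + 1)))
  linarith

end RobbinsMonro

end Deformation

namespace Deformation

/-! ### Sums of centred terms along the algorithm -/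

section Centred

variable {Ω : Type*} [MeasurableSpace Ω] {P : Measure Ω} {ε : ℕ → Ω → ℝ} {H : ℝ → ℝ → ℝ}
  {a b θ₀ : ℝ} {γ : ℕ → ℝ} {μ : Measure ℝ}

/-- The second moment of a sum of conditionally centred terms is at most the sum of the conditional
second moments. -/
theorem integral_sum_centred_sq_le [IsProbabilityMeasure P]
    (hε : ∀ n, Measurable (ε n)) (hindep : iIndepFun ε P) (hlaw : ∀ n, P.map (ε n) = μ)
    (hH : Measurable (Function.uncurry H)) (hab : a ≤ b) (hθ₀ : θ₀ ∈ Icc a b)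
    {w : ℕ → ℝ → ℝ → ℝ} (hw : ∀ n, Measurable (Function.uncurry (w n)))
    {B A : ℕ → ℝ} (hB : ∀ n, ∀ t ∈ Icc a b, ∀ e, |w n t e| ≤ B n)
    (h0 : ∀ n, ∀ t ∈ Icc a b, ∫ e, w n t e ∂μ = 0)
    (hA : ∀ n, ∀ t ∈ Icc a b, ∫ e, w n t e ^ 2 ∂μ ≤ A n) (n : ℕ) :
    Integrable (fun ω => (∑ i ∈ Finset.range n,
      w i (robbinsMonro H ε a b γ θ₀ i ω) (ε (i + 1) ω)) ^ 2) P ∧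
    ∫ ω, (∑ i ∈ Finset.range n,
      w i (robbinsMonro H ε a b γ θ₀ i ω) (ε (i + 1) ω)) ^ 2 ∂P ≤ ∑ i ∈ Finset.range n, A i := by
  set R := robbinsMonro H ε a b γ θ₀ with hR
  set S : ℕ → Ω → ℝ := fun n ω => ∑ i ∈ Finset.range n, w i (R i ω) (ε (i + 1) ω) with hS
  have hRI : ∀ n ω, R n ω ∈ Icc a b := fun n ω => robbinsMonro_mem_Icc hab hθ₀ n ω
  have hSsucc : ∀ n ω, S (n + 1) ω = S n ω + w n (R n ω) (ε (n + 1) ω) := fun n ω => by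
    simp [hS, Finset.sum_range_succ]
  -- The pair (parameter, partial sum) is itself driven by a recursion, so past sums and current
  -- parameter are jointly independent of the next noise variable.
  let F : ℕ → (ℝ × ℝ) × ℝ → ℝ × ℝ := fun n p =>
    (proj a b (p.1.1 - γ (n + 1) * H p.1.1 p.2), p.1.2 + w n p.1.1 p.2)
  have hpair : Measurable fun p : (ℝ × ℝ) × ℝ => (p.1.1, p.2) := by fun_prop
  have hF : ∀ n, Measurable (F n) := fun n =>
    ((measurable_robbinsMonro_step hH _).comp hpair).prodMk
      ((measurable_snd.comp measurable_fst).add ((hw n).comp hpair))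
  have hU0 : ∀ ω, (R 0 ω, S 0 ω) = (θ₀, 0) := fun ω => by simp [hS, hR, robbinsMonro]
  have hU : ∀ n ω, (R (n + 1) ω, S (n + 1) ω) = F n ((R n ω, S n ω), ε (n + 1) ω) := fun n ω => by
    rw [hSsucc]; rfl
  have hUm : ∀ n, Measurable fun ω => (R n ω, S n ω) :=
    measurable_of_recursion (U := fun n ω => (R n ω, S n ω)) hε hF hU0 hU
  have hUi : ∀ n, IndepFun (fun ω => (R n ω, S n ω)) (ε (n + 1)) P :=
    indepFun_of_recursion (U := fun n ω => (R n ω, S n ω)) hε hindep hF hU0 hU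
  have hRm : ∀ n, Measurable (R n) := fun n => (hUm n).fst
  have hSm : ∀ n, Measurable (S n) := fun n => (hUm n).snd
  have hwm : ∀ n, Measurable fun ω => w n (R n ω) (ε (n + 1) ω) := fun n =>
    (hw n).comp ((hRm n).prodMk (hε (n + 1)))
  have hwb : ∀ n ω, |w n (R n ω) (ε (n + 1) ω)| ≤ B n := fun n ω => hB n _ (hRI n ω) _
  have hSb : ∀ n ω, |S n ω| ≤ ∑ i ∈ Finset.range n, B i := fun n ω =>
    (Finset.abs_sum_le_sum_abs _ _).trans (Finset.sum_le_sum fun i _ => hwb i ω)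
  have hbdd : ∀ {g g' : Ω → ℝ} {c c' : ℝ}, Measurable g → Measurable g' → (∀ ω, |g ω| ≤ c) →
      (∀ ω, |g' ω| ≤ c') → Integrable (fun ω => g ω * g' ω) P := by
    intro g g' c c' hg hg' hc hc'
    refine integrable_of_measurable_of_abs_le (hg.mul hg') (C := c * c') fun ω => ?_
    rw [abs_mul]
    exact mul_le_mul (hc ω) (hc' ω) (abs_nonneg _) ((abs_nonneg _).trans (hc ω))
  have hSS : ∀ n, Integrable (fun ω => S n ω ^ 2) P := fun n => by
    simpa only [pow_two] using hbdd (hSm n) (hSm n) (hSb n) (hSb n)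
  have hww : ∀ n, Integrable (fun ω => w n (R n ω) (ε (n + 1) ω) ^ 2) P := fun n => by
    simpa only [pow_two] using hbdd (hwm n) (hwm n) (hwb n) (hwb n)
  have hSw : ∀ n, Integrable (fun ω => S n ω * w n (R n ω) (ε (n + 1) ω)) P := fun n =>
    hbdd (hSm n) (hwm n) (hSb n) (hwb n)
  refine ⟨hSS n, ?_⟩
  change ∫ ω, S n ω ^ 2 ∂P ≤ _
  induction n with
  | zero => simp [hS]
  | succ n ih =>
    -- Orthogonality of martingale increments: with the past frozen, the new term integrates to
    -- zero.
    have hcross : ∫ ω, S n ω * w n (R n ω) (ε (n + 1) ω) ∂P = 0 := by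
      have hm : Measurable fun p : (ℝ × ℝ) × ℝ => p.1.2 * w n p.1.1 p.2 :=
        (measurable_snd.comp measurable_fst).mul ((hw n).comp hpair)
      rw [integral_eq_of_indepFun (hUm n) (hε (n + 1)) (hUi n) hm (hSw n)]
      simp only [hlaw, integral_const_mul, h0 n _ (hRI n _), mul_zero, integral_zero]
    have hquad : ∫ ω, w n (R n ω) (ε (n + 1) ω) ^ 2 ∂P ≤ A n := by
      have hm : Measurable fun p : (ℝ × ℝ) × ℝ => w n p.1.1 p.2 ^ 2 :=
        Measurable.pow_const ((hw n).comp hpair) 2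
      have h2 := integrable_integral_of_indepFun (hUm n) (hε (n + 1)) (hUi n) hm (hww n)
      rw [integral_eq_of_indepFun (hUm n) (hε (n + 1)) (hUi n) hm (hww n)]
      simp only [hlaw] at h2 ⊢
      refine (integral_mono h2 (integrable_const (A n)) fun ω => hA n _ (hRI n ω)).trans ?_
      simp
    have hexp : ∀ ω, S (n + 1) ω ^ 2 = S n ω ^ 2 + 2 * (S n ω * w n (R n ω) (ε (n + 1) ω))
        + w n (R n ω) (ε (n + 1) ω) ^ 2 := fun ω => by rw [hSsucc]; ring
    have hsum : Integrable (fun ω => S n ω ^ 2 + 2 * (S n ω * w n (R n ω) (ε (n + 1) ω))) P :=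
      (hSS n).add ((hSw n).const_mul 2)
    simp_rw [hexp]
    rw [integral_add hsum (hww n), integral_add (hSS n) ((hSw n).const_mul 2),
      integral_const_mul, hcross, Finset.sum_range_succ]
    linarith

end Centred

/-! ### Kernel smoothing of a family of densities -/

section Smoothing

variable {μ : Measure ℝ} {k : ℝ → ℝ} {x fx : ℝ}

/-- Transfer to the law of g, then substitute z = x - h u. The bandwidth leaves the kernel and
enters the density, where continuity can be used. -/
theorem integral_kernel_eq {g F : ℝ → ℝ} (hk : Measurable k) (hg : Measurable g)
    (hF : Measurable F) (hFpos : ∀ z, 0 ≤ F z)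
    (hlaw : μ.map g = volume.withDensity fun z => ENNReal.ofReal (F z)) {h : ℝ} (hh : 0 < h) :
    ∫ e, 1 / h * k ((x - g e) / h) ∂μ = ∫ u, k u * F (x - h * u) := by
  have hm : Measurable fun z : ℝ => 1 / h * k ((x - z) / h) := by fun_prop
  rw [← integral_map (f := fun z => 1 / h * k ((x - z) / h)) hg.aemeasurable
    hm.aestronglyMeasurable, hlaw, integral_withDensity_eq_integral_toReal_smul
    hF.ennreal_ofReal (Eventually.of_forall fun _ => ENNReal.ofReal_lt_top)]
  have h1 : ∀ z, (ENNReal.ofReal (F z)).toReal • (1 / h * k ((x - z) / h)) =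
      |h⁻¹| * (F z * k ((x - z) / h)) := fun z => by
    rw [ENNReal.toReal_ofReal (hFpos z), abs_of_pos (inv_pos.2 hh), smul_eq_mul]
    ring
  simp_rw [h1]
  rw [integral_const_mul, ← integral_sub_left_eq_self (fun z => F z * k ((x - z) / h)) volume x,
    ← smul_eq_mul, ← Measure.integral_comp_mul_left (fun w => F (x - w) * k ((x - (x - w)) / h)) h]
  refine integral_congr_ae (Eventually.of_forall fun u => ?_)
  simp only [sub_sub_cancel]
  rw [mul_div_cancel_left₀ _ hh.ne', mul_comm]

theorem integral_kernel_le {F : ℝ → ℝ} (hkpos : ∀ u, 0 ≤ k u) (hkint : Integrable k)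
    (hkone : ∫ u, k u = 1) (hFpos : ∀ z, 0 ≤ F z) {C : ℝ} (hFC : ∀ z, F z ≤ C) (h : ℝ) :
    0 ≤ ∫ u, k u * F (x - h * u) ∧ ∫ u, k u * F (x - h * u) ≤ C := by
  refine ⟨integral_nonneg fun u => mul_nonneg (hkpos u) (hFpos _), ?_⟩
  calc ∫ u, k u * F (x - h * u) ≤ ∫ u, k u * C :=
        integral_mono_of_nonneg (Eventually.of_forall fun u => mul_nonneg (hkpos u) (hFpos _))
          (hkint.mul_const C)
          (Eventually.of_forall fun u => mul_le_mul_of_nonneg_left (hFC _) (hkpos u))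
    _ = C := by rw [integral_mul_const, hkone, one_mul]

/-- Kernel smoothing of a jointly continuous, bounded family of densities. -/
theorem tendsto_integral_kernel {F : ℝ → ℝ → ℝ} {s : Set ℝ} {θ : ℝ} (hkpos : ∀ u, 0 ≤ k u)
    (hkint : Integrable k) (hkone : ∫ u, k u = 1) (hF : ∀ t ∈ s, Measurable (F t))
    (hFpos : ∀ t ∈ s, ∀ z, 0 ≤ F t z) {C : ℝ} (hFC : ∀ t ∈ s, ∀ z, F t z ≤ C)
    (hlim : Tendsto (Function.uncurry F) (𝓝[s] θ ×ˢ 𝓝 x) (𝓝 fx)) :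
    Tendsto (fun p : ℝ × ℝ => ∫ u, k u * F p.2 (x - p.1 * u)) (𝓝[>] 0 ×ˢ 𝓝[s] θ) (𝓝 fx) := by
  have hs : ∀ᶠ p : ℝ × ℝ in 𝓝[>] 0 ×ˢ 𝓝[s] θ, p.2 ∈ s :=
    tendsto_snd.eventually self_mem_nhdsWithin
  have key : Tendsto (fun p : ℝ × ℝ => ∫ u, k u * F p.2 (x - p.1 * u)) (𝓝[>] 0 ×ˢ 𝓝[s] θ)
      (𝓝 (∫ u, k u * fx)) := by
    refine tendsto_integral_filter_of_dominated_convergence (fun u => k u * C) ?_ ?_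
      (hkint.mul_const C) (Eventually.of_forall fun u => ?_)
    · filter_upwards [hs] with p hp
      exact hkint.aestronglyMeasurable.mul
        ((hF _ hp).comp (by fun_prop : Measurable fun u => x - p.1 * u)).aestronglyMeasurable
    · filter_upwards [hs] with p hp
      refine Eventually.of_forall fun u => ?_
      rw [Real.norm_of_nonneg (mul_nonneg (hkpos u) (hFpos _ hp _))]
      exact mul_le_mul_of_nonneg_left (hFC _ hp _) (hkpos u)
    · refine Tendsto.const_mul _ ?_
      have h1 : Tendsto (fun p : ℝ × ℝ => x - p.1 * u) (𝓝[>] 0 ×ˢ 𝓝[s] θ) (𝓝 x) := by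
        have h2 : Tendsto (fun p : ℝ × ℝ => p.1) (𝓝[>] 0 ×ˢ 𝓝[s] θ) (𝓝 0) :=
          tendsto_fst.mono_right nhdsWithin_le_nhds
        simpa using (h2.mul_const u).const_sub x
      exact hlim.comp (tendsto_snd.prodMk h1)
  rwa [integral_mul_const, hkone, one_mul] at key

end Smoothing

/-! ### The recursive kernel estimator -/

section Estimator

variable {Ω : Type*} [MeasurableSpace Ω] {P : Measure Ω} {ε : ℕ → Ω → ℝ} {H : ℝ → ℝ → ℝ}
  {a b θ₀ θ : ℝ} {γ : ℕ → ℝ} {μ : Measure ℝ}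

/-- A bounded function of the parameter that is uniformly small near the limit of the algorithm is
small in mean square along the algorithm. -/
theorem tendsto_integral_comp_robbinsMonro_sq [IsProbabilityMeasure P]
    (hε : ∀ n, Measurable (ε n)) (hH : Measurable (Function.uncurry H)) (hθ : θ ∈ Icc a b)
    (hθ₀ : θ₀ ∈ Icc a b)
    (hV : Tendsto (fun n => ∫ ω, (robbinsMonro H ε a b γ θ₀ n ω - θ) ^ 2 ∂P) atTop (𝓝 0))
    {g : ℕ → ℝ → ℝ} {C : ℝ} (hC : ∀ n, ∀ t ∈ Icc a b, |g n t| ≤ C)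
    (hg : Tendsto (Function.uncurry g) (atTop ×ˢ 𝓝[Icc a b] θ) (𝓝 0)) :
    Tendsto (fun n => ∫ ω, g n (robbinsMonro H ε a b γ θ₀ n ω) ^ 2 ∂P) atTop (𝓝 0) := by
  have hC0 : 0 ≤ C := (abs_nonneg _).trans (hC 0 θ hθ)
  rw [Metric.tendsto_atTop]
  intro η hη
  have hη2 : 0 < Real.sqrt (η / 2) := Real.sqrt_pos.2 (by linarith)
  have h1 := Metric.tendsto_nhds.1 hg _ hη2
  obtain ⟨pa, hpa, pb, hpb, hp⟩ := eventually_prod_iff.1 h1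
  obtain ⟨δ, hδ, hball⟩ := Metric.mem_nhdsWithin_iff.1 hpb
  have h2 : Tendsto (fun n => η / 2 + C ^ 2 / δ ^ 2 *
      ∫ ω, (robbinsMonro H ε a b γ θ₀ n ω - θ) ^ 2 ∂P) atTop (𝓝 (η / 2 + C ^ 2 / δ ^ 2 * 0)) :=
    (hV.const_mul _).const_add _
  have h3 : ∀ᶠ n in atTop, η / 2 + C ^ 2 / δ ^ 2 *
      ∫ ω, (robbinsMonro H ε a b γ θ₀ n ω - θ) ^ 2 ∂P < η :=
    h2.eventually (gt_mem_nhds (by linarith))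
  obtain ⟨N, hN⟩ := eventually_atTop.1 (hpa.and h3)
  refine ⟨N, fun n hn => ?_⟩
  obtain ⟨hna, hn3⟩ := hN n hn
  rw [Real.dist_0_eq_abs, abs_of_nonneg (integral_nonneg fun _ => sq_nonneg _)]
  refine lt_of_le_of_lt ?_ hn3
  have hi := integrable_robbinsMonro_sub_sq (P := P) (γ := γ) hε hH hθ hθ₀ n
  have hbound : ∀ ω, g n (robbinsMonro H ε a b γ θ₀ n ω) ^ 2 ≤
      η / 2 + C ^ 2 / δ ^ 2 * (robbinsMonro H ε a b γ θ₀ n ω - θ) ^ 2 := by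
    intro ω
    set t := robbinsMonro H ε a b γ θ₀ n ω with ht
    have htI : t ∈ Icc a b := robbinsMonro_mem_Icc (hθ.1.trans hθ.2) hθ₀ n ω
    -- Near θ the uniform smallness of `g n` applies. Away from θ the crude bound C² is paid for by
    -- (t - θ)² / δ² ≥ 1, as in Chebyshev's inequality.
    by_cases hd : |t - θ| < δ
    · have h4 : dist (g n t) 0 < Real.sqrt (η / 2) :=
        hp hna (hball ⟨by simpa [Real.dist_eq] using hd, htI⟩)
      rw [Real.dist_0_eq_abs] at h4
      have h5 : g n t ^ 2 ≤ η / 2 := by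
        rw [← Real.sq_sqrt (by linarith : (0 : ℝ) ≤ η / 2), ← sq_abs (g n t)]
        exact pow_le_pow_left₀ (abs_nonneg _) h4.le 2
      have : 0 ≤ C ^ 2 / δ ^ 2 * (t - θ) ^ 2 := by positivity
      linarith
    · push Not at hd
      have h4 : δ ^ 2 ≤ (t - θ) ^ 2 := by
        rw [← sq_abs (t - θ)]; exact pow_le_pow_left₀ hδ.le hd 2
      have h5 : g n t ^ 2 ≤ C ^ 2 := by
        rw [← sq_abs (g n t)]; exact pow_le_pow_left₀ (abs_nonneg _) (hC n t htI) 2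
      have h6 : C ^ 2 ≤ C ^ 2 / δ ^ 2 * (t - θ) ^ 2 := by
        rw [div_mul_eq_mul_div, le_div_iff₀ (by positivity)]
        exact mul_le_mul_of_nonneg_left h4 (sq_nonneg C)
      linarith
  refine (integral_mono_of_nonneg (Eventually.of_forall fun _ => sq_nonneg _)
    ((integrable_const (η / 2)).add (hi.const_mul _)) (Eventually.of_forall hbound)).trans ?_
  simp only [Pi.add_apply]
  rw [integral_add (integrable_const _) (hi.const_mul _), integral_const_mul]
  simp

/-- Mean square consistency of the recursive kernel estimator along a consistent algorithm. -/
theorem tendsto_integral_kernelEstimator_sub_sq [IsProbabilityMeasure P]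
    (hε : ∀ n, Measurable (ε n)) (hindep : iIndepFun ε P) (hlaw : ∀ n, P.map (ε n) = μ)
    (hH : Measurable (Function.uncurry H)) (hθ : θ ∈ Icc a b) (hθ₀ : θ₀ ∈ Icc a b)
    (hV : Tendsto (fun n => ∫ ω, (robbinsMonro H ε a b γ θ₀ n ω - θ) ^ 2 ∂P) atTop (𝓝 0))
    {G : ℝ → ℝ → ℝ} (hG : Measurable (Function.uncurry G))
    {F : ℝ → ℝ → ℝ} (hF : ∀ t ∈ Icc a b, Measurable (F t))
    (hFpos : ∀ t ∈ Icc a b, ∀ z, 0 ≤ F t z) {C : ℝ} (hFC : ∀ t ∈ Icc a b, ∀ z, F t z ≤ C)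
    (hFlaw : ∀ t ∈ Icc a b, μ.map (G t) = volume.withDensity fun z => ENNReal.ofReal (F t z))
    {x fx : ℝ} (hlim : Tendsto (Function.uncurry F) (𝓝[Icc a b] θ ×ˢ 𝓝 x) (𝓝 fx))
    {k : ℝ → ℝ} (hk : Measurable k) (hkpos : ∀ u, 0 ≤ k u) {Ck : ℝ} (hkC : ∀ u, k u ≤ Ck)
    (hkint : Integrable k) (hkone : ∫ u, k u = 1)
    {h : ℕ → ℝ} (hhpos : ∀ n, 1 ≤ n → 0 < h n) (hhanti : ∀ m n, 1 ≤ m → m ≤ n → h n ≤ h m)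
    (hhzero : Tendsto h atTop (𝓝 0)) (hhn : Tendsto (fun n : ℕ => n * h n) atTop atTop) :
    (∀ n : ℕ, Integrable (fun ω => ((1 / (n : ℝ)) * ∑ i ∈ Finset.range n, 1 / h (i + 1) *
        k ((x - G (robbinsMonro H ε a b γ θ₀ i ω) (ε (i + 1) ω)) / h (i + 1)) - fx) ^ 2) P) ∧
    Tendsto (fun n : ℕ => ∫ ω, ((1 / (n : ℝ)) * ∑ i ∈ Finset.range n, 1 / h (i + 1) *
        k ((x - G (robbinsMonro H ε a b γ θ₀ i ω) (ε (i + 1) ω)) / h (i + 1)) - fx) ^ 2 ∂P)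
      atTop (𝓝 0) := by
  have hab : a ≤ b := hθ.1.trans hθ.2
  have : IsProbabilityMeasure μ := hlaw 0 ▸ Measure.isProbabilityMeasure_map (hε 0).aemeasurable
  set R := robbinsMonro H ε a b γ θ₀ with hR
  have hRm : ∀ n, Measurable (R n) := fun n => measurable_robbinsMonro hε hH n
  have hRI : ∀ n ω, R n ω ∈ Icc a b := fun n ω => robbinsMonro_mem_Icc hab hθ₀ n ω
  have hh : ∀ i, 0 < h (i + 1) := fun i => hhpos _ (by omega)
  have hCk : 0 ≤ Ck := (hkpos 0).trans (hkC 0)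
  have hC : 0 ≤ C := (hFpos θ hθ 0).trans (hFC θ hθ 0)
  let y : ℕ → ℝ → ℝ → ℝ := fun i t e => 1 / h (i + 1) * k ((x - G t e) / h (i + 1))
  let m : ℕ → ℝ → ℝ := fun i t => ∫ e, y i t e ∂μ
  have hym : ∀ i, Measurable (Function.uncurry (y i)) := fun i =>
    (hk.comp ((hG.const_sub x).div_const _)).const_mul _
  have hmm : ∀ i, Measurable (m i) := fun i =>
    (StronglyMeasurable.integral_prod_right (hym i).stronglyMeasurable).measurable
  have hGt : ∀ t, Measurable (G t) := fun t => hG.comp measurable_prodMk_left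
  have hyt : ∀ i t, Measurable (y i t) := fun i t => (hym i).comp measurable_prodMk_left
  have hy0 : ∀ i t e, 0 ≤ y i t e := fun i t e =>
    mul_nonneg (one_div_pos.2 (hh i)).le (hkpos _)
  have hyC : ∀ i t e, y i t e ≤ Ck / h (i + 1) := fun i t e => by
    rw [div_eq_inv_mul, ← one_div]
    exact mul_le_mul_of_nonneg_left (hkC _) (one_div_pos.2 (hh i)).le
  have hyi : ∀ i t, Integrable (y i t) μ := fun i t =>
    integrable_of_measurable_of_abs_le (hyt i t) fun e => by
      rw [abs_of_nonneg (hy0 i t e)]; exact hyC i t e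
  have hmeq : ∀ i, ∀ t ∈ Icc a b, m i t = ∫ u, k u * F t (x - h (i + 1) * u) := fun i t ht =>
    integral_kernel_eq hk (hGt t) (hF t ht) (hFpos t ht) (hFlaw t ht) (hh i)
  have hmb : ∀ i, ∀ t ∈ Icc a b, 0 ≤ m i t ∧ m i t ≤ C := fun i t ht => by
    rw [hmeq i t ht]
    exact integral_kernel_le hkpos hkint hkone (hFpos t ht) (hFC t ht) _
  -- the centred part
  have hcent := integral_sum_centred_sq_le (P := P) (γ := γ) hε hindep hlaw hH hab hθ₀
    (w := fun i t e => y i t e - m i t) (B := fun i => Ck / h (i + 1) + C)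
    (A := fun i => Ck * C / h (i + 1))
    (fun i => (hym i).sub ((hmm i).comp measurable_fst))
    (fun i t ht e => by
      have h1 := hy0 i t e
      have h2 := hyC i t e
      have h3 := hmb i t ht
      rw [abs_le]; constructor <;> linarith [h3.1, h3.2])
    (fun i t ht => by
      rw [integral_sub (hyi i t) (integrable_const _)]; simp [m])
    (fun i t ht => by
      have hsq : Integrable (fun e => y i t e ^ 2) μ := by
        refine integrable_of_measurable_of_abs_le ((hyt i t).pow_const 2)
          (C := (Ck / h (i + 1)) ^ 2) fun e => ?_
        rw [abs_of_nonneg (sq_nonneg _)]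
        exact pow_le_pow_left₀ (hy0 i t e) (hyC i t e) 2
      -- The variance is at most the second moment, hence at most sup y times the mean of y. One
      -- factor 1/h comes from the supremum; the mean is bounded by C whatever the bandwidth.
      have h1 : ∀ e, (y i t e - m i t) ^ 2 = y i t e ^ 2 - 2 * m i t * y i t e + m i t ^ 2 :=
        fun e => by ring
      have h2 : Integrable (fun e => y i t e ^ 2 - 2 * m i t * y i t e) μ :=
        hsq.sub ((hyi i t).const_mul _)
      simp_rw [h1]
      rw [integral_add h2 (integrable_const _),
        integral_sub hsq ((hyi i t).const_mul _), integral_const_mul]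
      have h3 : ∫ e, y i t e ^ 2 ∂μ ≤ Ck / h (i + 1) * m i t := by
        rw [← integral_const_mul]
        refine integral_mono hsq ((hyi i t).const_mul _) fun e => ?_
        simp only
        rw [pow_two]
        exact mul_le_mul_of_nonneg_right (hyC i t e) (hy0 i t e)
      have h4 : Ck / h (i + 1) * m i t ≤ Ck / h (i + 1) * C :=
        mul_le_mul_of_nonneg_left (hmb i t ht).2 (div_nonneg hCk (hh i).le)
      have h5 : Ck / h (i + 1) * C = Ck * C / h (i + 1) := by ring
      have h6 : ∫ e, y i t e ∂μ = m i t := rfl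
      rw [h6]
      simp only [integral_const, probReal_univ, smul_eq_mul, one_mul]
      nlinarith [sq_nonneg (m i t)])
  -- the bias
  have hmlim : Tendsto (Function.uncurry fun i t => m i t - fx) (atTop ×ˢ 𝓝[Icc a b] θ)
      (𝓝 0) := by
    have h1 := tendsto_integral_kernel hkpos hkint hkone hF hFpos hFC hlim
    have h2 : Tendsto (fun i : ℕ => h (i + 1)) atTop (𝓝[>] 0) :=
      tendsto_nhdsWithin_iff.2 ⟨hhzero.comp (tendsto_add_atTop_nat 1), Eventually.of_forall hh⟩
    have h3 := (h1.comp ((h2.comp tendsto_fst).prodMk tendsto_snd)).sub_const fx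
    rw [sub_self] at h3
    refine h3.congr' ?_
    filter_upwards [tendsto_snd.eventually self_mem_nhdsWithin] with p hp
    simp [Function.uncurry, hmeq p.1 p.2 hp]
  have hmfx : ∀ i, ∀ t ∈ Icc a b, |m i t - fx| ≤ C + |fx| := fun i t ht => by
    refine (abs_sub _ _).trans ?_
    rw [abs_of_nonneg (hmb i t ht).1]
    linarith [(hmb i t ht).2]
  have hbias := (tendsto_integral_comp_robbinsMonro_sq (P := P) (γ := γ) hε hH hθ hθ₀ hV
    hmfx hmlim).cesaro
  have hbi : ∀ i, Integrable (fun ω => (m i (R i ω) - fx) ^ 2) P := fun i => by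
    refine integrable_of_measurable_of_abs_le
      ((((hmm i).comp (hRm i)).sub_const fx).pow_const 2) (C := (C + |fx|) ^ 2) fun ω => ?_
    rw [abs_of_nonneg (sq_nonneg _), ← sq_abs]
    exact pow_le_pow_left₀ (abs_nonneg _) (hmfx i _ (hRI i ω)) 2
  have hYm : ∀ i, Measurable fun ω => y i (R i ω) (ε (i + 1) ω) := fun i =>
    (hym i).comp ((hRm i).prodMk (hε (i + 1)))
  have hEi : ∀ n : ℕ, Integrable (fun ω => ((1 / (n : ℝ)) * ∑ i ∈ Finset.range n,
      y i (R i ω) (ε (i + 1) ω) - fx) ^ 2) P := fun n => by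
    refine integrable_of_measurable_of_abs_le
      ((((Finset.measurable_sum _ fun i _ => hYm i).const_mul _).sub_const fx).pow_const 2)
      (C := ((1 / (n : ℝ)) * (∑ i ∈ Finset.range n, Ck / h (i + 1)) + |fx|) ^ 2) fun ω => ?_
    rw [abs_of_nonneg (sq_nonneg _), ← sq_abs]
    refine pow_le_pow_left₀ (abs_nonneg _) ((abs_sub _ _).trans ?_) 2
    have h1 : 0 ≤ ∑ i ∈ Finset.range n, y i (R i ω) (ε (i + 1) ω) :=
      Finset.sum_nonneg fun i _ => hy0 _ _ _
    rw [abs_of_nonneg (by positivity)]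
    gcongr with i
    exact hyC _ _ _
  refine ⟨hEi, ?_⟩
  have hdet : ∀ n : ℕ, 1 ≤ n → ∫ ω, ((1 / (n : ℝ)) * ∑ i ∈ Finset.range n,
      y i (R i ω) (ε (i + 1) ω) - fx) ^ 2 ∂P ≤ 2 * (Ck * C * (n * h n)⁻¹)
        + 2 * ((n : ℝ)⁻¹ * ∑ i ∈ Finset.range n, ∫ ω, (m i (R i ω) - fx) ^ 2 ∂P) := by
    intro n hn
    have hn0 : (0 : ℝ) < n := by exact_mod_cast hn
    have hhn0 : 0 < h n := hhpos n hn
    obtain ⟨hci, hcb⟩ := hcent n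
    -- As h is nonincreasing, every 1/h_i with i ≤ n is at most 1/h_n.
    have hcb' : (n : ℝ)⁻¹ ^ 2 * ∑ i ∈ Finset.range n, Ck * C / h (i + 1) ≤
        Ck * C * (n * h n)⁻¹ := by
      have h1 : ∑ i ∈ Finset.range n, Ck * C / h (i + 1) ≤
          ∑ i ∈ Finset.range n, Ck * C / h n := by
        refine Finset.sum_le_sum fun i hi => ?_
        have := hhanti (i + 1) n (by omega) (by have := Finset.mem_range.1 hi; omega)
        gcongr
      rw [Finset.sum_const, Finset.card_range, nsmul_eq_mul] at h1
      calc (n : ℝ)⁻¹ ^ 2 * ∑ i ∈ Finset.range n, Ck * C / h (i + 1)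
          ≤ (n : ℝ)⁻¹ ^ 2 * (n * (Ck * C / h n)) := by gcongr
        _ = _ := by field_simp
    have hpt : ∀ ω, ((1 / (n : ℝ)) * ∑ i ∈ Finset.range n,
        y i (R i ω) (ε (i + 1) ω) - fx) ^ 2 ≤
        2 * ((n : ℝ)⁻¹ ^ 2 * (∑ i ∈ Finset.range n, (y i (R i ω) (ε (i + 1) ω) - m i (R i ω))) ^ 2)
        + 2 * ((n : ℝ)⁻¹ * ∑ i ∈ Finset.range n, (m i (R i ω) - fx) ^ 2) := by
      intro ω
      set s₁ := ∑ i ∈ Finset.range n, (y i (R i ω) (ε (i + 1) ω) - m i (R i ω)) with hs₁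
      set s₂ := ∑ i ∈ Finset.range n, (m i (R i ω) - fx) with hs₂
      have h1 : (1 / (n : ℝ)) * ∑ i ∈ Finset.range n, y i (R i ω) (ε (i + 1) ω) - fx
          = (n : ℝ)⁻¹ * s₁ + (n : ℝ)⁻¹ * s₂ := by
        rw [hs₁, hs₂, Finset.sum_sub_distrib, Finset.sum_sub_distrib, Finset.sum_const,
          Finset.card_range, nsmul_eq_mul]
        field_simp
        ring
      -- Cauchy-Schwarz turns the squared mean bias into the Cesàro mean of squared biases.
      have h2 : s₂ ^ 2 ≤ n * ∑ i ∈ Finset.range n, (m i (R i ω) - fx) ^ 2 := by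
        have := sq_sum_le_card_mul_sum_sq (s := Finset.range n) (f := fun i => m i (R i ω) - fx)
        rwa [Finset.card_range] at this
      have h3 : ((n : ℝ)⁻¹ * s₂) ^ 2 ≤
          (n : ℝ)⁻¹ * ∑ i ∈ Finset.range n, (m i (R i ω) - fx) ^ 2 := by
        calc ((n : ℝ)⁻¹ * s₂) ^ 2 = (n : ℝ)⁻¹ ^ 2 * s₂ ^ 2 := by ring
          _ ≤ (n : ℝ)⁻¹ ^ 2 * (n * ∑ i ∈ Finset.range n, (m i (R i ω) - fx) ^ 2) := by gcongr
          _ = _ := by field_simp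
      rw [h1]
      nlinarith [sq_nonneg ((n : ℝ)⁻¹ * s₁ - (n : ℝ)⁻¹ * s₂)]
    have hi1 := (hci.const_mul ((n : ℝ)⁻¹ ^ 2)).const_mul 2
    have hi0 : Integrable (fun ω => ∑ i ∈ Finset.range n, (m i (R i ω) - fx) ^ 2) P :=
      integrable_finsetSum (Finset.range n) (fun i _ => hbi i)
    have hi2 := (hi0.const_mul (n : ℝ)⁻¹).const_mul 2
    have h5 := integral_mono (hEi n) (hi1.add hi2) hpt
    simp only [Pi.add_apply] at h5
    rw [integral_add hi1 hi2, integral_const_mul, integral_const_mul, integral_const_mul,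
      integral_const_mul, integral_finsetSum (Finset.range n) (fun i _ => hbi i)] at h5
    have h6 := mul_le_mul_of_nonneg_left hcb (sq_nonneg (n : ℝ)⁻¹)
    linarith
  refine tendsto_of_tendsto_of_tendsto_of_le_of_le' tendsto_const_nhds ?_
    (Eventually.of_forall fun n => integral_nonneg fun _ => sq_nonneg _)
    (eventually_atTop.2 ⟨1, hdet⟩)
  have h7 := ((tendsto_inv_atTop_zero.comp hhn).const_mul (Ck * C)).const_mul 2
  simpa using h7.add (hbias.const_mul 2)

end Estimator

end Deformation

namespace Deformation

/-! ### Measurability of functions given on a part of the real line -/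

theorem measurable_indicator_of_restrict {s : Set ℝ} (hs : MeasurableSet s) {g : ℝ → ℝ}
    (hg : Measurable (s.domRestrict g)) : Measurable (s.indicator g) := by
  refine measurable_of_restrict_of_restrict_compl hs ?_ ?_
  · have : s.domRestrict (s.indicator g) = s.domRestrict g :=
      funext fun x => indicator_of_mem x.2 _
    rwa [this]
  · have : sᶜ.domRestrict (s.indicator g) = fun _ => 0 := funext fun x => indicator_of_notMem x.2 _
    rw [this]
    exact measurable_const

theorem _root_.MonotoneOn.measurable_indicator {s : Set ℝ} (hs : MeasurableSet s) {g : ℝ → ℝ}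
    (hg : MonotoneOn g s) : Measurable (s.indicator g) :=
  measurable_indicator_of_restrict hs
    (Monotone.measurable fun x y hxy => hg x.2 y.2 hxy)

theorem _root_.ContinuousOn.measurable_indicator {s : Set ℝ} (hs : MeasurableSet s) {g : ℝ → ℝ}
    (hg : ContinuousOn g s) : Measurable (s.indicator g) :=
  measurable_indicator_of_restrict hs hg.domRestrict.measurable

/-! ### The inverse deformations -/

section Inverse

variable {φ : ℝ → ℝ → ℝ} {I₁ I₂ : Set ℝ} {t : ℝ}

theorem inv_apply (h : BijOn (φ t) I₁ I₂) {z : ℝ} (hz : z ∈ I₁) : inv φ I₁ t (φ t z) = z :=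
  h.injOn.leftInvOn_invFunOn hz

theorem inv_mem (h : BijOn (φ t) I₁ I₂) {y : ℝ} (hy : y ∈ I₂) : inv φ I₁ t y ∈ I₁ :=
  Function.invFunOn_mem (h.surjOn hy)

theorem apply_inv (h : BijOn (φ t) I₁ I₂) {y : ℝ} (hy : y ∈ I₂) : φ t (inv φ I₁ t y) = y :=
  Function.invFunOn_eq (h.surjOn hy)

theorem monotoneOn_inv (h : BijOn (φ t) I₁ I₂) (hm : StrictMonoOn (φ t) I₁) :
    MonotoneOn (inv φ I₁ t) I₂ := by
  intro y hy y' hy' hyy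
  by_contra! hlt
  have := hm (inv_mem h hy') (inv_mem h hy) hlt
  rw [apply_inv h hy, apply_inv h hy'] at this
  exact absurd hyy (not_le.2 this)

end Inverse

/-- The map `e ↦ φ_t⁻¹(φ_θ(e))` on `I₁`, extended by zero, at the projection of `t` on `[a, b]`. -/
noncomputable def registration (φ : ℝ → ℝ → ℝ) (I₁ : Set ℝ) (θ a b t e : ℝ) : ℝ :=
  I₁.indicator (fun e => inv φ I₁ (proj a b t) (φ θ e)) e

/-- The derivative in `t` of the registration map, at the projection of `t` on `[a, b]`. -/
noncomputable def dRegistration (φ : ℝ → ℝ → ℝ) (I₁ Θ : Set ℝ) (θ a b t e : ℝ) : ℝ :=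
  I₁.indicator (fun e => dInv φ I₁ Θ (proj a b t) (φ θ e)) e

section Registration

variable {φ : ℝ → ℝ → ℝ} {I₁ I₂ Θ : Set ℝ} {θ a b : ℝ}

theorem registration_of_mem {t e : ℝ} (ht : t ∈ Icc a b) (he : e ∈ I₁) :
    registration φ I₁ θ a b t e = inv φ I₁ t (φ θ e) := by
  rw [registration, indicator_of_mem he, proj_of_mem_Icc ht]

theorem dRegistration_of_mem {t e : ℝ} (ht : t ∈ Icc a b) (he : e ∈ I₁) :
    dRegistration φ I₁ Θ θ a b t e = dInv φ I₁ Θ t (φ θ e) := by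
  rw [dRegistration, indicator_of_mem he, proj_of_mem_Icc ht]

theorem uniqueDiffOn_of_ordConnected (hΘ : Θ.OrdConnected) (hab : a < b) (hI : Icc a b ⊆ Θ) :
    UniqueDiffOn ℝ Θ := by
  refine uniqueDiffOn_convex hΘ.convex ?_
  exact (nonempty_Ioo.2 hab).mono
    (interior_maximal (Ioo_subset_Icc_self.trans hI) isOpen_Ioo)

/-- A Carathéodory function: continuous in t on the whole line thanks to the projection, and
measurable in e because it is monotone on I₁ and zero elsewhere. -/
theorem measurable_registration (hI₁ : IsOpen I₁) (hab : a ≤ b) (hI : Icc a b ⊆ Θ) (hθ : θ ∈ Θ)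
    (hA1 : ∀ t ∈ Θ, StrictMonoOn (φ t) I₁ ∧ BijOn (φ t) I₁ I₂)
    (hA2 : ∀ y ∈ I₂, ContDiffOn ℝ 1 (fun t => inv φ I₁ t y) Θ) :
    Measurable (Function.uncurry (registration φ I₁ θ a b)) := by
  refine measurable_uncurry_of_continuous_of_measurable (fun e => ?_) fun t => ?_
  · by_cases he : e ∈ I₁
    · simp only [registration, indicator_of_mem he]
      exact (hA2 _ ((hA1 θ hθ).2.mapsTo he)).continuousOn.comp_continuous (continuous_proj a b)
        fun t => hI (proj_mem_Icc hab t)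
    · simp only [registration, indicator_of_notMem he]
      exact continuous_const
  · have ht := hI (proj_mem_Icc hab t)
    refine MonotoneOn.measurable_indicator hI₁.measurableSet fun e he e' he' hee => ?_
    exact monotoneOn_inv (hA1 _ ht).2 (hA1 _ ht).1 ((hA1 θ hθ).2.mapsTo he)
      ((hA1 θ hθ).2.mapsTo he') ((hA1 θ hθ).1.monotoneOn he he' hee)

theorem hasDerivWithinAt_registration (hI : Icc a b ⊆ Θ) (hθ : θ ∈ Θ)
    (hA1 : ∀ t ∈ Θ, StrictMonoOn (φ t) I₁ ∧ BijOn (φ t) I₁ I₂)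
    (hA2 : ∀ y ∈ I₂, ContDiffOn ℝ 1 (fun t => inv φ I₁ t y) Θ) {t : ℝ} (ht : t ∈ Icc a b) (e : ℝ) :
    HasDerivWithinAt (fun s => registration φ I₁ θ a b s e) (dRegistration φ I₁ Θ θ a b t e)
      (Icc a b) t := by
  by_cases he : e ∈ I₁
  · rw [dRegistration_of_mem ht he]
    have h1 := (((hA2 _ ((hA1 θ hθ).2.mapsTo he)).differentiableOn one_ne_zero) t
      (hI ht)).hasDerivWithinAt.mono hI
    exact h1.congr (fun s hs => registration_of_mem hs he) (registration_of_mem ht he)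
  · simp only [registration, dRegistration, indicator_of_notMem he]
    exact hasDerivWithinAt_const _ _ _

theorem continuous_dRegistration (hΘ : Θ.OrdConnected) (hab : a < b) (hI : Icc a b ⊆ Θ)
    (hθ : θ ∈ Θ) (hA1 : ∀ t ∈ Θ, StrictMonoOn (φ t) I₁ ∧ BijOn (φ t) I₁ I₂)
    (hA2 : ∀ y ∈ I₂, ContDiffOn ℝ 1 (fun t => inv φ I₁ t y) Θ) (e : ℝ) :
    Continuous fun t => dRegistration φ I₁ Θ θ a b t e := by
  by_cases he : e ∈ I₁
  · simp only [dRegistration, indicator_of_mem he]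
    exact ((hA2 _ ((hA1 θ hθ).2.mapsTo he)).continuousOn_derivWithin
      (uniqueDiffOn_of_ordConnected hΘ hab hI) le_rfl).comp_continuous (continuous_proj a b)
      fun t => hI (proj_mem_Icc hab.le t)
  · simp only [dRegistration, indicator_of_notMem he]
    exact continuous_const

theorem neBot_nhdsWithin_Icc_diff_singleton (hab : a < b) {t : ℝ} (ht : t ∈ Icc a b) :
    (𝓝[Icc a b \ {t}] t).NeBot := by
  have := (uniqueDiffOn_Icc hab) t ht
  rw [uniqueDiffWithinAt_iff_accPt] at this
  rwa [accPt_principal_iff_nhdsWithin] at this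

/-- For fixed t it is a pointwise limit of difference quotients of `registration`, hence measurable
in e; continuity in t gives joint measurability. -/
theorem measurable_dRegistration (hI₁ : IsOpen I₁) (hΘ : Θ.OrdConnected) (hab : a < b)
    (hI : Icc a b ⊆ Θ) (hθ : θ ∈ Θ)
    (hA1 : ∀ t ∈ Θ, StrictMonoOn (φ t) I₁ ∧ BijOn (φ t) I₁ I₂)
    (hA2 : ∀ y ∈ I₂, ContDiffOn ℝ 1 (fun t => inv φ I₁ t y) Θ) :
    Measurable (Function.uncurry (dRegistration φ I₁ Θ θ a b)) := by
  refine measurable_uncurry_of_continuous_of_measurable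
    (continuous_dRegistration hΘ hab hI hθ hA1 hA2) fun t => ?_
  have hp := proj_mem_Icc hab.le t
  have hGm := measurable_registration hI₁ hab.le hI hθ hA1 hA2
  have := neBot_nhdsWithin_Icc_diff_singleton hab hp
  have hproj : dRegistration φ I₁ Θ θ a b t = dRegistration φ I₁ Θ θ a b (proj a b t) := by
    unfold dRegistration; rw [proj_of_mem_Icc hp]
  rw [hproj]
  refine measurable_of_tendsto_metrizable' (𝓝[Icc a b \ {proj a b t}] (proj a b t))
    (f := fun s e => slope (fun s => registration φ I₁ θ a b s e) (proj a b t) s) (fun s => ?_)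
    (tendsto_pi_nhds.2 fun e => ?_)
  · simp only [slope_def_field]
    exact ((hGm.comp measurable_prodMk_left).sub (hGm.comp measurable_prodMk_left)).div_const _
  · exact hasDerivWithinAt_iff_tendsto_slope.1
      (hasDerivWithinAt_registration hI hθ hA1 hA2 hp e)

end Registration

/-- The envelope of the parameter derivative has a fourth moment. -/
theorem exists_envelope_dRegistration {Ω : Type*} [MeasurableSpace Ω] {P : Measure Ω}
    {φ : ℝ → ℝ → ℝ} {I₁ Θ : Set ℝ} {θ a b : ℝ} (hab : a ≤ b) {e₀ : Ω → ℝ}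
    (he₀ : Measurable e₀)
    (hm : Measurable (Function.uncurry (dRegistration φ I₁ Θ θ a b)))
    (hc : ∀ e, Continuous fun t => dRegistration φ I₁ Θ θ a b t e)
    (hA4 : ∫⁻ ω, ⨆ t ∈ Icc a b, ‖dInv φ I₁ Θ t (φ θ (e₀ ω))‖ₑ ^ 4 ∂P < ⊤) :
    ∃ L : ℝ → ℝ, Measurable L ∧ (∀ e, 0 ≤ L e) ∧ Integrable (fun e => L e ^ 4) (P.map e₀) ∧
      ∀ᵐ e ∂(P.map e₀), ∀ t, |dRegistration φ I₁ Θ θ a b t e| ≤ L e := by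
  set D := dRegistration φ I₁ Θ θ a b with hD
  -- A countable supremum is measurable; by continuity in t, a bound on a dense sequence holds for
  -- all t. The envelope is the fourth root of `S`.
  let S : ℝ → ENNReal := fun e => ⨆ n, ‖D (TopologicalSpace.denseSeq ℝ n) e‖ₑ ^ 4
  have hSm : Measurable S := Measurable.iSup fun n =>
    (hm.comp (measurable_prodMk_left (x := TopologicalSpace.denseSeq ℝ n))).enorm.pow_const 4
  have hSfin : ∫⁻ e, S e ∂(P.map e₀) ≠ ⊤ := by
    rw [lintegral_map hSm he₀]
    refine (lt_of_le_of_lt (lintegral_mono fun ω => ?_) hA4).ne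
    refine iSup_le fun n => ?_
    by_cases he : e₀ ω ∈ I₁
    · simp only [hD, dRegistration, indicator_of_mem he]
      exact le_iSup₂ (f := fun t (_ : t ∈ Icc a b) => ‖dInv φ I₁ Θ t (φ θ (e₀ ω))‖ₑ ^ 4)
        (proj a b (TopologicalSpace.denseSeq ℝ n)) (proj_mem_Icc hab _)
    · simp [hD, dRegistration, indicator_of_notMem he]
  have hS4 : ∀ e, Real.sqrt (Real.sqrt (S e).toReal) ^ 4 = (S e).toReal := fun e => by
    rw [show (4 : ℕ) = 2 * 2 from rfl, pow_mul, Real.sq_sqrt (Real.sqrt_nonneg _),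
      Real.sq_sqrt ENNReal.toReal_nonneg]
  refine ⟨fun e => Real.sqrt (Real.sqrt (S e).toReal), hSm.ennreal_toReal.sqrt.sqrt,
    fun e => Real.sqrt_nonneg _, ?_, ?_⟩
  · simp_rw [hS4]
    exact integrable_toReal_of_lintegral_ne_top hSm.aemeasurable hSfin
  · filter_upwards [ae_lt_top hSm hSfin] with e he t
    have h1 : ‖D t e‖ₑ ^ 4 ≤ S e := by
      have hcl : IsClosed {t | ‖D t e‖ₑ ^ 4 ≤ S e} :=
        isClosed_le ((ENNReal.continuous_pow 4).comp (hc e).enorm) continuous_const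
      have hsub : closure (range (TopologicalSpace.denseSeq ℝ)) ⊆ {t | ‖D t e‖ₑ ^ 4 ≤ S e} := by
        refine hcl.closure_subset_iff.2 ?_
        rintro _ ⟨n, rfl⟩
        exact le_iSup (fun n => ‖D (TopologicalSpace.denseSeq ℝ n) e‖ₑ ^ 4) n
      rw [(TopologicalSpace.denseRange_denseSeq ℝ).closure_range] at hsub
      exact hsub (mem_univ t)
    have h2 := ENNReal.toReal_mono he.ne h1
    rw [ENNReal.toReal_pow, toReal_enorm, Real.norm_eq_abs, ← hS4 e] at h2
    exact le_of_pow_le_pow_left₀ (by norm_num) (Real.sqrt_nonneg _) h2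

/-! ### The criterion -/

section Criterion

variable {μ : Measure ℝ} {G D : ℝ → ℝ → ℝ} {L : ℝ → ℝ} {a b θ : ℝ}

/-- The mean value inequality on the segment, with one exceptional null set for all pairs of
parameters. For s = θ it controls the registration error by the distance to θ. -/
theorem abs_sub_le_envelope (hL : ∀ᵐ e ∂μ, ∀ t, |D t e| ≤ L e)
    (hGD : ∀ t ∈ Icc a b, ∀ e, HasDerivWithinAt (fun s => G s e) (D t e) (Icc a b) t) :
    ∀ᵐ e ∂μ, ∀ s ∈ Icc a b, ∀ t ∈ Icc a b, |G t e - G s e| ≤ L e * |t - s| := by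
  filter_upwards [hL] with e he s hs t ht
  exact (convex_Icc a b).norm_image_sub_le_of_norm_hasDerivWithin_le (f := fun t => G t e)
    (fun r hr => hGD r hr e) (fun r _ => he r) hs ht

theorem integrable_envelope_sq [IsProbabilityMeasure μ] (hLm : Measurable L) (hL4 : Integrable (fun e => L e ^ 4) μ) :
    Integrable (fun e => L e ^ 2) μ := by
  refine ((memLp_two_iff_integrable_sq (hLm.pow_const 2).aestronglyMeasurable).2 ?_).integrable
    one_le_two
  simpa only [← pow_mul] using hL4

/-- Differentiation under the integral sign for the mean square registration error, up to the end
points of the segment. -/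
theorem hasDerivWithinAt_integral_sub_sq [IsProbabilityMeasure μ] (hLm : Measurable L)
    (hL4 : Integrable (fun e => L e ^ 4) μ) (hL : ∀ᵐ e ∂μ, ∀ t, |D t e| ≤ L e)
    (hGm : Measurable (Function.uncurry G))
    (hGD : ∀ t ∈ Icc a b, ∀ e, HasDerivWithinAt (fun s => G s e) (D t e) (Icc a b) t)
    (hθ : θ ∈ Icc a b) (hGθ : ∀ᵐ e ∂μ, G θ e = e) {t : ℝ} (ht : t ∈ Icc a b) :
    HasDerivWithinAt (fun s => ∫ e, (G s e - e) ^ 2 ∂μ) (∫ e, -2 * D t e * (e - G t e) ∂μ)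
      (Icc a b) t := by
  have hlip := abs_sub_le_envelope hL hGD
  have hL2 := integrable_envelope_sq hLm hL4
  have hm : ∀ s, Measurable fun e => (G s e - e) ^ 2 := fun s =>
    ((hGm.comp measurable_prodMk_left).sub measurable_id).pow_const 2
  have hdist : ∀ s ∈ Icc a b, ∀ r ∈ Icc a b, |s - r| ≤ b - a := fun s hs r hr => by
    rw [abs_le]; constructor <;> linarith [hs.1, hs.2, hr.1, hr.2]
  have hd : ∀ᵐ e ∂μ, 0 ≤ L e ∧ ∀ s ∈ Icc a b, |G s e - e| ≤ L e * (b - a) := by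
    filter_upwards [hlip, hGθ, hL] with e h1 h2 h3
    have hL0 : 0 ≤ L e := (abs_nonneg _).trans (h3 θ)
    refine ⟨hL0, fun s hs => ?_⟩
    have := h1 θ hθ s hs
    rw [h2] at this
    exact this.trans (mul_le_mul_of_nonneg_left (hdist s hs θ hθ) hL0)
  have hint : ∀ s ∈ Icc a b, Integrable (fun e => (G s e - e) ^ 2) μ := fun s hs => by
    refine (hL2.mul_const ((b - a) ^ 2)).mono' (hm s).aestronglyMeasurable ?_
    filter_upwards [hd] with e he
    rw [Real.norm_of_nonneg (sq_nonneg _), ← sq_abs, ← mul_pow]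
    exact pow_le_pow_left₀ (abs_nonneg _) (he.2 s hs) 2
  rw [hasDerivWithinAt_iff_tendsto_slope]
  have hmem : ∀ᶠ s in 𝓝[Icc a b \ {t}] t, s ∈ Icc a b \ {t} := self_mem_nhdsWithin
  -- Dominated convergence is applied to the slopes themselves, which treats the end points like
  -- interior points. Factoring a difference of squares gives the dominating function.
  have key : Tendsto (fun s => ∫ e, slope (fun s => (G s e - e) ^ 2) t s ∂μ)
      (𝓝[Icc a b \ {t}] t) (𝓝 (∫ e, -2 * D t e * (e - G t e) ∂μ)) := by
    refine tendsto_integral_filter_of_dominated_convergence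
      (fun e => L e ^ 2 * (2 * (b - a))) ?_ ?_ (hL2.mul_const _) ?_
    · refine Eventually.of_forall fun s => Measurable.aestronglyMeasurable ?_
      simp only [slope_def_field]
      exact ((hm s).sub (hm t)).div_const _
    · filter_upwards [hmem] with s hs
      filter_upwards [hd, hlip] with e he h1
      have hst : 0 < |s - t| := abs_pos.2 (sub_ne_zero.2 hs.2)
      rw [slope_def_field, Real.norm_eq_abs, abs_div, div_le_iff₀ hst]
      have h2 : (G s e - e) ^ 2 - (G t e - e) ^ 2 =
          (G s e - G t e) * ((G s e - e) + (G t e - e)) := by ring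
      have h3 : |(G s e - e) + (G t e - e)| ≤ 2 * (L e * (b - a)) :=
        (abs_add_le _ _).trans (by linarith [he.2 s hs.1, he.2 t ht])
      rw [h2, abs_mul]
      calc |G s e - G t e| * |(G s e - e) + (G t e - e)|
          ≤ (L e * |s - t|) * (2 * (L e * (b - a))) :=
            mul_le_mul (h1 t ht s hs.1) h3 (abs_nonneg _) (mul_nonneg he.1 (abs_nonneg _))
        _ = _ := by ring
    · refine Eventually.of_forall fun e => ?_
      have h1 := ((hGD t ht e).sub_const e).pow 2
      have h0 : -2 * D t e * (e - G t e) = ((2 : ℕ) : ℝ) * (G t e - e) ^ (2 - 1) * D t e := by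
        norm_num; ring
      rw [h0]
      exact hasDerivWithinAt_iff_tendsto_slope.1 h1
  refine key.congr' ?_
  filter_upwards [hmem] with s hs
  simp only [slope_def_field]
  rw [integral_div, integral_sub (hint s hs.1) (hint t ht)]

/-- A lower bound on the second derivative makes the first derivative strongly monotone around a
minimum. -/
theorem sq_div_two_le_of_half_le_derivWithin {m : ℝ → ℝ} {Θ : Set ℝ} (hI : Icc a b ⊆ Θ)
    (hθ : θ ∈ Ioo a b) (hmin : ∀ t, m θ ≤ m t)
    (h2 : ∀ t ∈ Icc a b, 1 / 2 ≤ derivWithin (derivWithin m Θ) Θ t) {t : ℝ} (ht : t ∈ Icc a b) :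
    (t - θ) ^ 2 / 2 ≤ (t - θ) * derivWithin m Θ t := by
  have hnhds : Θ ∈ 𝓝 θ := mem_of_superset (Icc_mem_nhds hθ.1 hθ.2) hI
  have h0 : derivWithin m Θ θ = 0 := by
    rw [derivWithin_of_mem_nhds hnhds]
    exact IsLocalMin.deriv_eq_zero (Eventually.of_forall hmin)
  have hder : ∀ s ∈ Icc a b, HasDerivWithinAt (fun s => derivWithin m Θ s - s / 2)
      (derivWithin (derivWithin m Θ) Θ s - 1 / 2) (Icc a b) s := fun s hs => by
    -- Without differentiability `derivWithin` would take its default value 0, below 1/2.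
    have hd : DifferentiableWithinAt ℝ (derivWithin m Θ) Θ s := by
      by_contra hnot
      have := h2 s hs
      rw [derivWithin_zero_of_not_differentiableWithinAt hnot] at this
      norm_num at this
    exact (hd.hasDerivWithinAt.mono hI).sub ((hasDerivWithinAt_id s _).div_const 2)
  have hmono : MonotoneOn (fun s => derivWithin m Θ s - s / 2) (Icc a b) := by
    refine monotoneOn_of_hasDerivWithinAt_nonneg (convex_Icc a b)
      (f' := fun s => derivWithin (derivWithin m Θ) Θ s - 1 / 2)
      (fun s hs => (hder s hs).continuousWithinAt)
      (fun s hs => (hder s (interior_subset hs)).mono interior_subset) fun s hs => ?_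
    linarith [h2 s (interior_subset hs)]
  have hθI : θ ∈ Icc a b := Ioo_subset_Icc_self hθ
  rcases le_total θ t with h | h
  · have := hmono hθI ht h
    simp only [h0] at this
    nlinarith
  · have := hmono ht hθI h
    simp only [h0] at this
    nlinarith

end Criterion

end Deformation

namespace Deformation

/-! ### The density of the registered variables -/

/-- The density of `φ_t⁻¹(φ_θ(ε))` when `ε` has density `f` on `I₁`. -/
noncomputable def registeredDensity (φ : ℝ → ℝ → ℝ) (I₁ I₂ : Set ℝ) (θ : ℝ) (f : ℝ → ℝ)
    (t z : ℝ) : ℝ :=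
  I₁.indicator (fun z => f (inv φ I₁ θ (φ t z)) *
    |derivWithin (inv φ I₁ θ) I₂ (φ t z) * derivWithin (φ t) I₁ z|) z

section Density

variable {φ : ℝ → ℝ → ℝ} {I₁ I₂ : Set ℝ} {θ t : ℝ} {f : ℝ → ℝ}

theorem registeredDensity_nonneg (hf : ∀ x ∈ I₁, 0 ≤ f x) (hθ : BijOn (φ θ) I₁ I₂)
    (ht : BijOn (φ t) I₁ I₂) (z : ℝ) : 0 ≤ registeredDensity φ I₁ I₂ θ f t z :=
  indicator_nonneg (fun _ hz => mul_nonneg (hf _ (inv_mem hθ (ht.mapsTo hz))) (abs_nonneg _)) z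

/-- The constants enter through their absolute values so that the bound stays nonnegative off I₁,
where the density is zero. -/
theorem registeredDensity_le (hθ : BijOn (φ θ) I₁ I₂) (ht : BijOn (φ t) I₁ I₂)
    {C₀ C₁ C₂ : ℝ} (h0 : ∀ x ∈ I₁, |f x| ≤ C₀)
    (h1 : ∀ y ∈ I₂, |derivWithin (inv φ I₁ θ) I₂ y| ≤ C₁)
    (h2 : ∀ x ∈ I₁, |derivWithin (φ t) I₁ x| ≤ C₂) (z : ℝ) :
    registeredDensity φ I₁ I₂ θ f t z ≤ |C₀| * (|C₁| * |C₂|) := by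
  by_cases hz : z ∈ I₁
  · rw [registeredDensity, indicator_of_mem hz, abs_mul]
    have hy := ht.mapsTo hz
    refine mul_le_mul ?_ (mul_le_mul ?_ ?_ (abs_nonneg _) (abs_nonneg _)) (by positivity)
      (abs_nonneg _)
    · exact (le_abs_self _).trans ((h0 _ (inv_mem hθ hy)).trans (le_abs_self _))
    · exact (h1 _ hy).trans (le_abs_self _)
    · exact (h2 _ hz).trans (le_abs_self _)
  · rw [registeredDensity, indicator_of_notMem hz]
    positivity

/-- The derivative of the inverse deformation is the inverse of the derivative. -/
theorem derivWithin_inv_mul_derivWithin (hI₁ : IsOpen I₁) (hθ : BijOn (φ θ) I₁ I₂)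
    (hφ : DifferentiableOn ℝ (φ θ) I₁) (hinv : DifferentiableOn ℝ (inv φ I₁ θ) I₂) {w : ℝ}
    (hw : w ∈ I₁) :
    derivWithin (inv φ I₁ θ) I₂ (φ θ w) * derivWithin (φ θ) I₁ w = 1 := by
  have h1 := HasDerivWithinAt.comp w (hinv _ (hθ.mapsTo hw)).hasDerivWithinAt
    (hφ w hw).hasDerivWithinAt hθ.mapsTo
  have h2 : HasDerivWithinAt (inv φ I₁ θ ∘ φ θ) 1 I₁ w :=
    (hasDerivWithinAt_id w I₁).congr (fun z hz => inv_apply hθ hz) (inv_apply hθ hw)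
  exact UniqueDiffWithinAt.eq_deriv I₁ (hI₁.uniqueDiffWithinAt hw) h1 h2

/-- This reduces continuity of the derivative of the inverse to continuity of dφ_θ on the open set
I₁; I₂ itself is not assumed open or uniquely differentiable. -/
theorem derivWithin_inv_eq (hI₁ : IsOpen I₁) (hθ : BijOn (φ θ) I₁ I₂)
    (hφ : DifferentiableOn ℝ (φ θ) I₁) (hinv : DifferentiableOn ℝ (inv φ I₁ θ) I₂) {y : ℝ}
    (hy : y ∈ I₂) :
    derivWithin (inv φ I₁ θ) I₂ y = (derivWithin (φ θ) I₁ (inv φ I₁ θ y))⁻¹ := by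
  have h := derivWithin_inv_mul_derivWithin hI₁ hθ hφ hinv (inv_mem hθ hy)
  rw [apply_inv hθ hy] at h
  exact eq_inv_of_mul_eq_one_left h

theorem measurable_registeredDensity (hI₁ : IsOpen I₁) (hθ : BijOn (φ θ) I₁ I₂)
    (ht : BijOn (φ t) I₁ I₂) (hf : ContinuousOn f I₁) (hφθ : ContDiffOn ℝ 1 (φ θ) I₁)
    (hφt : ContDiffOn ℝ 1 (φ t) I₁) (hinv : DifferentiableOn ℝ (inv φ I₁ θ) I₂) :
    Measurable (registeredDensity φ I₁ I₂ θ f t) := by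
  refine ContinuousOn.measurable_indicator hI₁.measurableSet ?_
  have hψ : ContinuousOn (fun z => inv φ I₁ θ (φ t z)) I₁ :=
    hinv.continuousOn.comp hφt.continuousOn ht.mapsTo
  have hψm : MapsTo (fun z => inv φ I₁ θ (φ t z)) I₁ I₁ := fun z hz =>
    inv_mem hθ (ht.mapsTo hz)
  have hdθ := (hφθ.continuousOn_derivWithin hI₁.uniqueDiffOn le_rfl).comp hψ hψm
  refine (hf.comp hψ hψm).mul (ContinuousOn.abs (ContinuousOn.mul ?_
    (hφt.continuousOn_derivWithin hI₁.uniqueDiffOn le_rfl)))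
  refine (hdθ.inv₀ fun z hz => ?_).congr fun z hz =>
    derivWithin_inv_eq hI₁ hθ (hφθ.differentiableOn one_ne_zero) hinv (ht.mapsTo hz)
  exact right_ne_zero_of_mul_eq_one (derivWithin_inv_mul_derivWithin hI₁ hθ
    (hφθ.differentiableOn one_ne_zero) hinv (hψm hz))

/-- Change of variables: the law of the registered variable. -/
theorem map_eq_withDensity_registeredDensity (hI₁ : IsOpen I₁)
    (hθ : BijOn (φ θ) I₁ I₂) (ht : BijOn (φ t) I₁ I₂) (hφt : DifferentiableOn ℝ (φ t) I₁)
    (hinv : DifferentiableOn ℝ (inv φ I₁ θ) I₂) {g : ℝ → ℝ} (hg : Measurable g)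
    (hgI : ∀ e ∈ I₁, g e = inv φ I₁ t (φ θ e)) :
    ((volume.restrict I₁).withDensity fun x => ENNReal.ofReal (f x)).map g =
      volume.withDensity fun z => ENNReal.ofReal (registeredDensity φ I₁ I₂ θ f t z) := by
  set ψ : ℝ → ℝ := fun z => inv φ I₁ θ (φ t z) with hψdef
  have hψm : MapsTo ψ I₁ I₁ := fun z hz => inv_mem hθ (ht.mapsTo hz)
  have hgψ : ∀ z ∈ I₁, g (ψ z) = z := fun z hz => by
    rw [hgI _ (hψm hz), hψdef]
    simp only
    rw [apply_inv hθ (ht.mapsTo hz), inv_apply ht hz]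
  have himg : ψ '' I₁ = I₁ := by
    refine Subset.antisymm hψm.image_subset fun e he => ?_
    refine ⟨inv φ I₁ t (φ θ e), inv_mem ht (hθ.mapsTo he), ?_⟩
    rw [hψdef]
    simp only
    rw [apply_inv ht (hθ.mapsTo he), inv_apply hθ he]
  have hinj : InjOn ψ I₁ := fun z hz z' hz' h => by rw [← hgψ z hz, ← hgψ z' hz', h]
  have hder : ∀ z ∈ I₁, HasDerivWithinAt ψ
      (derivWithin (inv φ I₁ θ) I₂ (φ t z) * derivWithin (φ t) I₁ z) I₁ z := fun z hz =>
    HasDerivWithinAt.comp z (hinv _ (ht.mapsTo hz)).hasDerivWithinAt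
      (hφt z hz).hasDerivWithinAt ht.mapsTo
  ext s hs
  rw [Measure.map_apply hg hs, withDensity_apply _ (hg hs), withDensity_apply _ hs,
    ← lintegral_indicator (hg hs), ← lintegral_indicator hs]
  -- ψ = φ_θ⁻¹ ∘ φ_t maps I₁ bijectively onto itself and g inverts it, so e = ψ(z) is the change of
  -- variables.
  nth_rewrite 1 [← himg]
  rw [lintegral_image_eq_lintegral_abs_deriv_mul hI₁.measurableSet hder hinj,
    ← lintegral_indicator hI₁.measurableSet]
  refine lintegral_congr fun z => ?_
  by_cases hz : z ∈ I₁
  · rw [indicator_of_mem hz]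
    by_cases hzs : z ∈ s
    · have h1 : ψ z ∈ g ⁻¹' s := by rw [mem_preimage, hgψ z hz]; exact hzs
      rw [indicator_of_mem h1, indicator_of_mem hzs, registeredDensity, indicator_of_mem hz,
        ← ENNReal.ofReal_mul (abs_nonneg _), mul_comm]
    · have h1 : ψ z ∉ g ⁻¹' s := by rw [mem_preimage, hgψ z hz]; exact hzs
      rw [indicator_of_notMem h1, indicator_of_notMem hzs, mul_zero]
  · rw [indicator_of_notMem hz]
    by_cases hzs : z ∈ s
    · rw [indicator_of_mem hzs, registeredDensity, indicator_of_notMem hz, ENNReal.ofReal_zero]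
    · rw [indicator_of_notMem hzs]

/-- Joint continuity of the registered density at the true parameter. -/
theorem tendsto_registeredDensity {Θ : Set ℝ} {a b x : ℝ} (hI₁ : IsOpen I₁)
    (hI : Icc a b ⊆ Θ) (hθab : θ ∈ Ioo a b) (hbij : ∀ t ∈ Θ, BijOn (φ t) I₁ I₂)
    (hf : ContinuousOn f I₁) (hφθ : ContDiffOn ℝ 1 (φ θ) I₁)
    (hinv : DifferentiableOn ℝ (inv φ I₁ θ) I₂)
    (hφ : ContDiffOn ℝ 2 (fun p : ℝ × ℝ => φ p.1 p.2) (Θ ×ˢ I₁)) (hx : x ∈ I₁) :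
    Tendsto (Function.uncurry (registeredDensity φ I₁ I₂ θ f)) (𝓝[Icc a b] θ ×ˢ 𝓝 x)
      (𝓝 (f x)) := by
  have hΘ : Θ ∈ 𝓝 θ := mem_of_superset (Icc_mem_nhds hθab.1 hθab.2) hI
  have hθΘ : θ ∈ Θ := mem_of_mem_nhds hΘ
  have hθ := hbij θ hθΘ
  have hmem : ∀ᶠ p : ℝ × ℝ in 𝓝 (θ, x), p ∈ Θ ×ˢ I₁ := prod_mem_nhds hΘ (hI₁.mem_nhds hx)
  have hat : ContDiffAt ℝ 2 (fun p : ℝ × ℝ => φ p.1 p.2) (θ, x) := hφ.contDiffAt hmem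
  have hdφ : Tendsto (fun p : ℝ × ℝ => derivWithin (φ p.1) I₁ p.2) (𝓝 (θ, x))
      (𝓝 (derivWithin (φ θ) I₁ x)) := by
    -- The x-derivative is the total derivative in the direction (0, 1), which is what makes it
    -- jointly continuous in (t, x).
    have hc : ContinuousAt (fun p : ℝ × ℝ =>
        fderiv ℝ (fun p : ℝ × ℝ => φ p.1 p.2) p ((0 : ℝ), (1 : ℝ))) (θ, x) :=
      (hat.fderiv_right (m := 1) (by norm_num [one_add_one_eq_two])).continuousAt.clm_apply
        continuousAt_const
    have heq : ∀ᶠ p : ℝ × ℝ in 𝓝 (θ, x),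
        fderiv ℝ (fun p : ℝ × ℝ => φ p.1 p.2) p ((0 : ℝ), (1 : ℝ)) =
          derivWithin (φ p.1) I₁ p.2 := by
      filter_upwards [hat.eventually (by simp), hmem] with p hp hpm
      have h1 := (hp.differentiableAt two_ne_zero).hasFDerivAt
      have h2 : HasDerivAt (fun z : ℝ => (p.1, z)) ((0 : ℝ), (1 : ℝ)) p.2 :=
        (hasDerivAt_const p.2 p.1).prodMk (hasDerivAt_id p.2)
      have h3 : HasDerivAt (φ p.1)
          (fderiv ℝ (fun p : ℝ × ℝ => φ p.1 p.2) p ((0 : ℝ), (1 : ℝ))) p.2 :=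
        HasFDerivAt.comp_hasDerivAt (f := fun z : ℝ => (p.1, z))
          (l := fun p : ℝ × ℝ => φ p.1 p.2) p.2 h1 h2
      rw [derivWithin_of_isOpen hI₁ hpm.2, h3.deriv]
    have h4 := hc.tendsto.congr' heq
    rwa [heq.self_of_nhds] at h4
  have hψ : Tendsto (fun p : ℝ × ℝ => inv φ I₁ θ (φ p.1 p.2)) (𝓝 (θ, x)) (𝓝 x) := by
    have h1 : Tendsto (fun p : ℝ × ℝ => φ p.1 p.2) (𝓝 (θ, x)) (𝓝[I₂] (φ θ x)) :=
      tendsto_nhdsWithin_iff.2 ⟨hat.continuousAt,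
        hmem.mono fun p hp => (hbij p.1 hp.1).mapsTo hp.2⟩
    have h2 := (hinv.continuousOn _ (hθ.mapsTo hx)).tendsto.comp h1
    rwa [inv_apply hθ hx] at h2
  have hprod := derivWithin_inv_mul_derivWithin hI₁ hθ (hφθ.differentiableOn one_ne_zero) hinv hx
  have hdinv : Tendsto (fun p : ℝ × ℝ => derivWithin (inv φ I₁ θ) I₂ (φ p.1 p.2)) (𝓝 (θ, x))
      (𝓝 (derivWithin (inv φ I₁ θ) I₂ (φ θ x))) := by
    rw [derivWithin_inv_eq hI₁ hθ (hφθ.differentiableOn one_ne_zero) hinv (hθ.mapsTo hx),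
      inv_apply hθ hx]
    have h1 := ((hφθ.continuousOn_derivWithin hI₁.uniqueDiffOn le_rfl).continuousAt
      (hI₁.mem_nhds hx)).tendsto.comp hψ
    refine (h1.inv₀ (right_ne_zero_of_mul_eq_one hprod)).congr' ?_
    filter_upwards [hmem] with p hp
    exact (derivWithin_inv_eq hI₁ hθ (hφθ.differentiableOn one_ne_zero) hinv
      ((hbij p.1 hp.1).mapsTo hp.2)).symm
  have hfψ := ((hf.continuousAt (hI₁.mem_nhds hx)).tendsto.comp hψ)
  have key := hfψ.mul (hdinv.mul hdφ).abs
  rw [hprod, abs_one, mul_one] at key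
  have key2 : Tendsto (Function.uncurry (registeredDensity φ I₁ I₂ θ f)) (𝓝 (θ, x))
      (𝓝 (f x)) := by
    refine key.congr' ?_
    filter_upwards [hmem] with p hp
    simp only [Function.uncurry, registeredDensity]
    rw [indicator_of_mem hp.2]
    rfl
  rw [nhds_prod_eq] at key2
  exact key2.mono_left (prod_mono_left _ nhdsWithin_le_nhds)

end Density

end Deformation

namespace Deformation

/-! ### Passage to the regularized algorithm -/

/-- The iterates stay in [a,b] and the noise in I₁, so neither the projection nor the cutoff acts
along this trajectory. -/
theorem thetaHat_eq_robbinsMonro {Ω : Type*} {φ : ℝ → ℝ → ℝ} {I₁ Θ : Set ℝ} {θ a b θ₀ : ℝ}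
    {ε : ℕ → Ω → ℝ} {γ : ℕ → ℝ} (hab : a ≤ b) (hθ₀ : θ₀ ∈ Icc a b) {ω : Ω}
    (hω : ∀ n, ε n ω ∈ I₁) (n : ℕ) :
    thetaHat φ I₁ Θ θ ε a b γ θ₀ n ω = robbinsMonro (fun t e =>
      -2 * dRegistration φ I₁ Θ θ a b t e * (e - registration φ I₁ θ a b t e)) ε a b γ θ₀ n ω := by
  induction n with
  | zero => rfl
  | succ n ih =>
    rw [thetaHat, robbinsMonro, ih]
    have h1 := robbinsMonro_mem_Icc (ε := ε) (γ := γ) (H := fun t e =>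
      -2 * dRegistration φ I₁ Θ θ a b t e * (e - registration φ I₁ θ a b t e)) hab hθ₀ n ω
    rw [T, X, dRegistration_of_mem h1 (hω (n + 1)), registration_of_mem h1 (hω (n + 1))]

/-- An integrable kernel agrees almost everywhere with a Borel one that keeps its bounds. -/
theorem exists_measurable_kernel {K : ℝ → ℝ} (hKpos : ∀ u, 0 ≤ K u) (hKint : Integrable K)
    {C : ℝ} (hKC : ∀ u, K u ≤ C) :
    ∃ k : ℝ → ℝ, Measurable k ∧ (∀ u, 0 ≤ k u) ∧ (∀ u, k u ≤ C) ∧ K =ᵐ[volume] k := by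
  have hC : 0 ≤ C := (hKpos 0).trans (hKC 0)
  refine ⟨fun u => proj 0 C (hKint.aestronglyMeasurable.mk K u),
    (continuous_proj 0 C).measurable.comp hKint.aestronglyMeasurable.stronglyMeasurable_mk.measurable,
    fun u => (proj_mem_Icc hC _).1, fun u => (proj_mem_Icc hC _).2, ?_⟩
  filter_upwards [hKint.aestronglyMeasurable.ae_eq_mk] with u hu
  rw [← hu, proj_of_mem_Icc ⟨hKpos u, hKC u⟩]

/-- Two almost everywhere equal kernels give almost surely the same estimator terms. -/
theorem ae_kernel_eq {Ω : Type*} [MeasurableSpace Ω] {P : Measure Ω} [IsProbabilityMeasure P]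
    {U e : Ω → ℝ} (hU : Measurable U) (he : Measurable e) (hind : IndepFun U e P)
    {G : ℝ → ℝ → ℝ} (hG : Measurable (Function.uncurry G))
    (hac : ∀ ω, (P.map e).map (G (U ω)) ≪ volume) {K k : ℝ → ℝ} (hKk : K =ᵐ[volume] k)
    {x h : ℝ} (hh : h ≠ 0) :
    ∀ᵐ ω ∂P, K ((x - G (U ω) (e ω)) / h) = k ((x - G (U ω) (e ω)) / h) := by
  -- A Borel null set containing the discrepancy makes the event measurable in (u, e); its preimage
  -- under z ↦ (x - z) / h is again null.
  obtain ⟨N, hNsub, hNm, hN0⟩ := exists_measurable_superset_of_null (ae_iff.1 hKk)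
  have hq : Measurable fun z : ℝ => (x - z) / h := by fun_prop
  have hnull : ∀ᵐ z : ℝ, (x - z) / h ∉ N := by
    rw [ae_iff]
    simp only [not_not]
    have h1 : {z : ℝ | (x - z) / h ∈ N} = (fun z => x - z) ⁻¹' ((fun z => z * h⁻¹) ⁻¹' N) := by
      ext z; simp [div_eq_mul_inv]
    rw [h1, (Measure.measurePreserving_sub_left volume x).measure_preimage
      (hNm.preimage (measurable_mul_const h⁻¹)).nullMeasurableSet,
      Real.volume_preimage_mul_right (inv_ne_zero hh), hN0, mul_zero]
  have hGt : ∀ t, Measurable (G t) := fun t => hG.comp measurable_prodMk_left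
  have hs : MeasurableSet {p : ℝ × ℝ | (x - G p.1 p.2) / h ∈ Nᶜ} := (hq.comp hG) hNm.compl
  have h2 := ae_of_indepFun hU he hind hs fun ω =>
    ae_of_ae_map (hGt _).aemeasurable ((hac ω).ae_le hnull)
  filter_upwards [h2] with ω hω
  by_contra hne
  exact hω (hNsub hne)

theorem sum_Icc_one_eq_sum_range {E : Type*} [AddCommMonoid E] (g : ℕ → E) (n : ℕ) :
    ∑ i ∈ Finset.Icc 1 n, g i = ∑ i ∈ Finset.range n, g (i + 1) := by
  rw [Finset.range_eq_Ico, Finset.sum_Ico_add' g 0 n 1]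
  rfl

end Deformation

/-! ### Mean square consistency of the density estimator -/

open Deformation in
theorem theorem4p2 {Ω : Type*} [MeasurableSpace Ω] (P : Measure Ω) [IsProbabilityMeasure P]
    -- the deformation family, the parameter set and the true parameter
    (φ : ℝ → ℝ → ℝ) (I₁ I₂ Θ : Set ℝ) (hI₁ : IsOpen I₁) (hΘ : Θ.OrdConnected)
    (θ a b : ℝ) (ha : a ∈ Θ) (hb : b ∈ Θ) (haθ : a < θ) (hθb : θ < b)
    -- the i.i.d. sequence, with values in I₁ and density f
    (ε : ℕ → Ω → ℝ) (hε : ∀ n, Measurable (ε n)) (hindep : iIndepFun ε P)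
    (f : ℝ → ℝ) (hf : ∀ x ∈ I₁, 0 ≤ f x)
    (hdens : ∀ n, P.map (ε n) =
      (volume.restrict I₁).withDensity (fun x => ENNReal.ofReal (f x)))
    -- (A1)
    (hA1 : ∀ t ∈ Θ, StrictMonoOn (φ t) I₁ ∧ BijOn (φ t) I₁ I₂)
    -- (A2)
    (hA2 : ∀ y ∈ I₂, ContDiffOn ℝ 1 (fun t => Deformation.inv φ I₁ t y) Θ)
    -- (A3)
    (hA3 : ∀ t ∈ Θ, MemLp (fun ω => Deformation.inv φ I₁ t (φ θ (ε 0 ω))) 2 P)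
    -- (A4)
    (hA4 : ∀ B ⊆ Θ, IsCompact B →
      ∫⁻ ω, ⨆ t ∈ B, ‖Deformation.dInv φ I₁ Θ t (φ θ (ε 0 ω))‖ₑ ^ 4 ∂P < ⊤)
    -- (A5)
    (hA5 : ∀ t ∈ Icc a b, t ≠ θ → 0 < (t - θ) * Deformation.dM P φ I₁ Θ θ ε t)
    -- (A6)
    (hA6 : ∀ y ∈ I₂, DifferentiableOn ℝ (fun t => Deformation.dInv φ I₁ Θ t y) Θ)
    (hA6' : ∀ B ⊆ Θ, IsCompact B →
      ∫⁻ ω, ⨆ t ∈ B, ‖Deformation.ddInv φ I₁ Θ t (φ θ (ε 0 ω))‖ₑ ^ 2 ∂P < ⊤)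
    -- (A7)
    (hA7 : ∀ t ∈ Icc a b, 1 / 2 ≤ Deformation.ddM P φ I₁ Θ θ ε t)
    -- (AD1)
    (hAD1 : ContDiffOn ℝ 2 f I₁)
    (hAD1' : ∀ k ≤ 2, ∃ C, ∀ x ∈ I₁, |iteratedDerivWithin k f I₁ x| ≤ C)
    -- (AD2)
    (hAD2 : ∀ t ∈ Θ, ContDiffOn ℝ 3 (φ t) I₁)
    -- (AD3)
    (hAD3 : ContDiffOn ℝ 3 (Deformation.inv φ I₁ θ) I₂)
    (hAD3' : ∀ k, 1 ≤ k → k ≤ 3 → ∃ C, ∀ y ∈ I₂,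
      |iteratedDerivWithin k (Deformation.inv φ I₁ θ) I₂ y| ≤ C)
    -- (AD4)
    (hAD4 : ∀ k, 1 ≤ k → k ≤ 3 → ∃ C, ∀ t ∈ Θ, ∀ x ∈ I₁,
      |iteratedDerivWithin k (φ t) I₁ x| ≤ C)
    -- (AD5)
    (hAD5 : ContDiffOn ℝ 2 (fun p : ℝ × ℝ => φ p.1 p.2) (Θ ×ˢ I₁))
    (hAD5' : ∀ x ∈ I₁, ∃ C, ∀ t ∈ Θ,
      |derivWithin (fun s => φ s x) Θ t| ≤ C ∧
      |derivWithin (fun s => derivWithin (φ s) I₁ x) Θ t| ≤ C)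
    -- the steps of the Robbins-Monro algorithm and its initial value
    (γ : ℕ → ℝ) (hγpos : ∀ n, 1 ≤ n → 0 < γ n) (hγanti : ∀ m n, 1 ≤ m → m ≤ n → γ n ≤ γ m)
    (hγsum : ¬ Summable (fun n => γ (n + 1))) (hγsq : Summable (fun n => γ (n + 1) ^ 2))
    (θ₀ : ℝ) (hθ₀ : θ₀ ∈ Icc a b)
    -- the kernel
    (K : ℝ → ℝ) (hKpos : ∀ u, 0 ≤ K u) (hKsymm : ∀ u, K (-u) = K u)
    (hKint : Integrable K) (hKbdd : ∃ C, ∀ u, K u ≤ C) (hKone : ∫ u, K u = 1)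
    (hKlim : Tendsto (fun u => |u| * K u) (cocompact ℝ) (𝓝 0))
    (hKsq : Integrable (fun u => u ^ 2 * K u))
    -- the bandwidths
    (h : ℕ → ℝ) (hhpos : ∀ n, 1 ≤ n → 0 < h n) (hhanti : ∀ m n, 1 ≤ m → m ≤ n → h n ≤ h m)
    (hhzero : Tendsto h atTop (𝓝 0)) (hhn : Tendsto (fun n : ℕ => n * h n) atTop atTop) :
    ∀ x ∈ I₁,
      (∀ n, Integrable
        (fun ω => |Deformation.fHat φ I₁ Θ θ ε a b γ θ₀ K h n x ω - f x| ^ 2) P) ∧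
      Tendsto
        (fun n => ∫ ω, |Deformation.fHat φ I₁ Θ θ ε a b γ θ₀ K h n x ω - f x| ^ 2 ∂P)
        atTop (𝓝 0) := by
  intro x hx
  have hab : a < b := haθ.trans hθb
  have hI : Icc a b ⊆ Θ := hΘ.out ha hb
  have hθI : θ ∈ Icc a b := ⟨haθ.le, hθb.le⟩
  have hθΘ : θ ∈ Θ := hI hθI
  set μ := (volume.restrict I₁).withDensity fun x => ENNReal.ofReal (f x)
  have : IsProbabilityMeasure μ :=
    hdens 0 ▸ Measure.isProbabilityMeasure_map (hε 0).aemeasurable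
  have hμI : ∀ᵐ e ∂μ, e ∈ I₁ :=
    (withDensity_absolutelyContinuous _ _).ae_le (ae_restrict_mem hI₁.measurableSet)
  have hεI : ∀ᵐ ω ∂P, ∀ n, ε n ω ∈ I₁ := ae_all_iff.2 fun n => by
    rw [← hdens n] at hμI
    exact ae_of_ae_map (hε n).aemeasurable hμI
  set G := registration φ I₁ θ a b with hGdef
  set D := dRegistration φ I₁ Θ θ a b with hDdef
  set H : ℝ → ℝ → ℝ := fun t e => -2 * D t e * (e - G t e) with hHdef
  have hGm : Measurable (Function.uncurry G) := measurable_registration hI₁ hab.le hI hθΘ hA1 hA2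
  have hDm : Measurable (Function.uncurry D) :=
    measurable_dRegistration hI₁ hΘ hab hI hθΘ hA1 hA2
  have hHm : Measurable (Function.uncurry H) := (hDm.const_mul (-2)).mul (measurable_snd.sub hGm)
  have hGD : ∀ t ∈ Icc a b, ∀ e, HasDerivWithinAt (fun s => G s e) (D t e) (Icc a b) t :=
    fun t ht e => hasDerivWithinAt_registration hI hθΘ hA1 hA2 ht e
  have hGθ : ∀ᵐ e ∂μ, G θ e = e := hμI.mono fun e he => by
    rw [hGdef, registration_of_mem hθI he, inv_apply (hA1 θ hθΘ).2 he]
  -- the envelope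
  obtain ⟨L, hLm, hL0, hL4, hL⟩ := exists_envelope_dRegistration (P := P) hab.le (hε 0) hDm
    (continuous_dRegistration hΘ hab hI hθΘ hA1 hA2) (hA4 _ hI isCompact_Icc)
  rw [hdens 0] at hL4 hL
  -- the criterion and its derivative
  have hM : ∀ t ∈ Icc a b, M P φ I₁ θ ε t = ∫ e, (G t e - e) ^ 2 ∂μ := fun t ht => by
    have hm : Measurable fun e => (G t e - e) ^ 2 :=
      ((hGm.comp measurable_prodMk_left).sub measurable_id).pow_const 2
    rw [← hdens 0, integral_map (hε 0).aemeasurable hm.aestronglyMeasurable]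
    refine integral_congr_ae ?_
    filter_upwards [hεI] with ω hω
    simp only [Z, X, sq_abs]
    rw [hGdef, registration_of_mem ht (hω 0)]
  have hMder : ∀ t ∈ Icc a b,
      HasDerivWithinAt (M P φ I₁ θ ε) (∫ e, H t e ∂μ) (Icc a b) t := fun t ht =>
    (hasDerivWithinAt_integral_sub_sq hLm hL4 hL hGm hGD hθI hGθ ht).congr hM (hM t ht)
  have hMmin : ∀ t, M P φ I₁ θ ε θ ≤ M P φ I₁ θ ε t := fun t => by
    have h0 : M P φ I₁ θ ε θ = 0 := by
      rw [hM θ hθI]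
      refine integral_eq_zero_of_ae ?_
      filter_upwards [hGθ] with e he
      simp [he]
    rw [h0]
    exact integral_nonneg fun _ => sq_nonneg _
  have hmono : ∀ t ∈ Icc a b, (t - θ) ^ 2 / 2 ≤ (t - θ) * ∫ e, H t e ∂μ := by
    intro t ht
    rcases eq_or_ne t θ with rfl | hne
    · simp
    -- Assumption (A5) excludes the default value 0 of `derivWithin`, so M is differentiable within
    -- Θ here and M' can be compared with the derivative found on [a,b].
    · have hd : DifferentiableWithinAt ℝ (M P φ I₁ θ ε) Θ t := by
        by_contra hnot
        have := hA5 t ht hne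
        rw [dM, derivWithin_zero_of_not_differentiableWithinAt hnot, mul_zero] at this
        exact lt_irrefl _ this
      rw [← UniqueDiffWithinAt.eq_deriv (Icc a b) (uniqueDiffOn_Icc hab t ht)
        (hd.hasDerivWithinAt.mono hI) (hMder t ht)]
      exact sq_div_two_le_of_half_le_derivWithin hI ⟨haθ, hθb⟩ hMmin hA7 ht
  -- the algorithm
  have hQ : MemLp (fun e => 2 * L e ^ 2) 2 μ := by
    refine (memLp_two_iff_integrable_sq
      ((hLm.pow_const 2).const_mul 2).aestronglyMeasurable).2 ?_
    refine (hL4.const_mul 4).congr (Eventually.of_forall fun e => ?_)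
    simp only
    ring
  have hHQ : ∀ᵐ e ∂μ, ∀ t ∈ Icc a b, |H t e| ≤ 2 * L e ^ 2 * |t - θ| := by
    filter_upwards [hL, abs_sub_le_envelope hL hGD, hGθ] with e h1 h2 h3 t ht
    have h4 := h2 θ hθI t ht
    rw [h3, abs_sub_comm] at h4
    rw [hHdef]
    simp only
    rw [abs_mul, abs_mul, abs_neg, abs_two]
    calc 2 * |D t e| * |e - G t e| ≤ 2 * L e * (L e * |t - θ|) := by
          have := h1 t
          have := hL0 e
          gcongr
      _ = _ := by ring
  have hV := tendsto_integral_robbinsMonro_sub_sq hε hindep hdens hHm hθI hθ₀ hQ hHQ hmono hγpos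
    hγsum hγsq
  -- the density of the registered variables
  have hbij : ∀ t ∈ Θ, BijOn (φ t) I₁ I₂ := fun t ht => (hA1 t ht).2
  have hfc : ContinuousOn f I₁ := hAD1.continuousOn
  have hφ1 : ∀ t ∈ Θ, ContDiffOn ℝ 1 (φ t) I₁ := fun t ht => (hAD2 t ht).of_le (by norm_num)
  have hinv : DifferentiableOn ℝ (inv φ I₁ θ) I₂ := hAD3.differentiableOn (by norm_num)
  obtain ⟨C₀, hC₀⟩ := hAD1' 0 (by norm_num)
  obtain ⟨C₁, hC₁⟩ := hAD3' 1 le_rfl (by norm_num)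
  obtain ⟨C₂, hC₂⟩ := hAD4 1 le_rfl (by norm_num)
  simp only [iteratedDerivWithin_zero] at hC₀
  simp only [iteratedDerivWithin_one] at hC₁ hC₂
  have hFlaw : ∀ t ∈ Icc a b, μ.map (G t) =
      volume.withDensity fun z => ENNReal.ofReal (registeredDensity φ I₁ I₂ θ f t z) :=
    fun t ht => map_eq_withDensity_registeredDensity hI₁ (hbij θ hθΘ) (hbij t (hI ht))
      ((hφ1 t (hI ht)).differentiableOn one_ne_zero) hinv (hGm.comp measurable_prodMk_left)
      fun e he => registration_of_mem ht he
  -- the kernel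
  obtain ⟨CK, hCK⟩ := hKbdd
  obtain ⟨k, hkm, hkpos, hkC, hKk⟩ := exists_measurable_kernel hKpos hKint hCK
  obtain ⟨hint, hlim⟩ := tendsto_integral_kernelEstimator_sub_sq hε hindep hdens hHm hθI hθ₀ hV hGm
    (fun t ht => measurable_registeredDensity hI₁ (hbij θ hθΘ) (hbij t (hI ht)) hfc (hφ1 θ hθΘ)
      (hφ1 t (hI ht)) hinv)
    (fun t ht => registeredDensity_nonneg hf (hbij θ hθΘ) (hbij t (hI ht)))
    (fun t ht => registeredDensity_le (hbij θ hθΘ) (hbij t (hI ht)) hC₀ hC₁ (hC₂ t (hI ht)))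
    hFlaw
    (tendsto_registeredDensity hI₁ hI ⟨haθ, hθb⟩ hbij hfc (hφ1 θ hθΘ) hinv hAD5 hx)
    hkm hkpos hkC (hKint.congr hKk) ((integral_congr_ae hKk).symm.trans hKone)
    hhpos hhanti hhzero hhn
  have hterm : ∀ᵐ ω ∂P, ∀ i,
      K ((x - G (robbinsMonro H ε a b γ θ₀ i ω) (ε (i + 1) ω)) / h (i + 1)) =
        k ((x - G (robbinsMonro H ε a b γ θ₀ i ω) (ε (i + 1) ω)) / h (i + 1)) :=
    ae_all_iff.2 fun i => ae_kernel_eq (measurable_robbinsMonro hε hHm i) (hε (i + 1))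
      (indepFun_robbinsMonro hε hindep hHm i) hGm
      (fun ω => by
        rw [hdens, hFlaw _ (robbinsMonro_mem_Icc hab.le hθ₀ i ω)]
        exact withDensity_absolutelyContinuous _ _)
      hKk (hhpos _ (by omega)).ne'
  have heq : ∀ n : ℕ, (fun ω => ((1 / (n : ℝ)) * ∑ i ∈ Finset.range n, 1 / h (i + 1) *
      k ((x - G (robbinsMonro H ε a b γ θ₀ i ω) (ε (i + 1) ω)) / h (i + 1)) - f x) ^ 2) =ᵐ[P]
      fun ω => |fHat φ I₁ Θ θ ε a b γ θ₀ K h n x ω - f x| ^ 2 := fun n => by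
    filter_upwards [hterm, hεI] with ω h1 h2
    rw [sq_abs, fHat, sum_Icc_one_eq_sum_range]
    congr 3
    refine Finset.sum_congr rfl fun i _ => ?_
    -- After the shift of index, (i + 1) - 1 = i: observation i + 1 is registered with the parameter
    -- computed before it.
    rw [← h1 i, add_tsub_cancel_right, thetaHat_eq_robbinsMonro hab.le hθ₀ h2 i, Z, X, hGdef,
      registration_of_mem (robbinsMonro_mem_Icc hab.le hθ₀ i ω) (h2 (i + 1))]
  exact ⟨fun n => (hint n).congr (heq n), hlim.congr fun n => integral_congr_ae (heq n)⟩
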